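/- Let $G$ be a finite simple nonplanar graph with an edge $uv$ such that $G-uv$ is cubic, planar and $3$-connected, and suppose that $G_{u,v}:=G-\{u,v\}$ is internally $3$-connected, i.e. it is $2$-connected and whenever $G_{u,v}$ is the union of two edge-disjoint subgraphs $G_1,G_2$ with exactly two common vertices, $|E(G_1)|\le 2$ or $|E(G_2)|\le 2$. Let $u_1,u_2,u_3$ be the neighbours of $u$ other than $v$, and $v_1,v_2,v_3$ the neighbours of $v$ other than $u$. Fix a plane embedding of $G-uv$ and the embedding of $G_{u,v}$ that it induces; let $\mathcal F$ be the set of faces of the latter and $G^*_{u,v}$ its dual (multi)graph, with vertex set $\mathcal F$. For a weight assignment $\omega$ on $E(G)$, let $\omega^*$ be the weight assignment on $G^*_{u,v}$ given by $\omega^*(e^*)=\omega(e)$ for $e\in E(G_{u,v})$; let $d_{\omega^*}(F,F')$ be the length of a shortest $FF'$-path in $(G^*_{u,v},\omega^*)$, and for a vertex $x$ of $G_{u,v}$ let $d_{\omega^*}(x,F)$ be the minimum of $d_{\omega^*}(F',F)$ over the faces $F'$ incident with $x$. Then there is exactly one face $F_u\in\mathcal F$ incident with all of $u_1,u_2,u_3$,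 there is exactly one face $F_v\in\mathcal F$ incident with all of $v_1,v_2,v_3$, and there is a weight assignment $\omega$ on $E(G)$ with positive integer values such that: 1. every edge of $G^*_{u,v}$ belongs to a shortest $F_uF_v$-path in $(G^*_{u,v},\omega^*)$; 2. $\omega(e)\,\omega(e')>d_{\omega^*}(F_u,F_v)\cdot\omega(uv)$ for all edges $e,e'$ of $G_{u,v}$; 3. $\sum_{j=1}^3 d_{\omega^*}(u_j,F)\cdot\omega(uu_j)\ge d_{\omega^*}(F_u,F)\cdot\omega(uv)$ for every $F\in\mathcal F$; 4. for each $i\in\{1,2,3\}$ there is $U_i\in\mathcal F$ with $d_{\omega^*}(u_i,U_i)>0$ and $\sum_{j=1}^3 d_{\omega^*}(u_j,U_i)\cdot\omega(uu_j)=d_{\omega^*}(F_u,U_i)\cdot\omega(uv)$; 5. $\sum_{j=1}^3 d_{\omega^*}(v_j,F)\cdot\omega(vv_j)\ge d_{\omega^*}(F_v,F)\cdot\omega(uv)$ for every $F\in\mathcal F$; 6. for each $i\in\{1,2,3\}$ there is $V_i\in\mathcal F$ with $d_{\omega^*}(v_i,V_i)>0$ and $\sum_{j=1}^3 d_{\omega^*}(v_j,V_i)\cdot\omega(vv_j)=d_{\omega^*}(F_v,V_i)\cdot\omega(uv)$;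 7. $\omega(uu_i)\cdot\omega(vv_j)<\frac19\min\{\omega(e): e\in E(G_{u,v})\}$ for all $i,j\in\{1,2,3\}$. -/

import Mathlib

namespace SimpleGraph

/-- A graph is `k`-connected if it has more than `k` vertices and no set of fewer than `k` vertices
disconnects it. -/
def IsVertexConnected {V : Type*} (G : SimpleGraph V) (k : ℕ) : Prop :=
  k < Nat.card V ∧ ∀ S : Set V, S.ncard < k → (G.induce Sᶜ).Connected

/-- A separation of order `k`: two edge-disjoint subgraphs with union `G` that have exactly `k`
vertices in common. -/
def IsSeparation {V : Type*} {G : SimpleGraph V} (A B : G.Subgraph) (k : ℕ) : Prop :=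
  A ⊔ B = ⊤ ∧ Disjoint A.edgeSet B.edgeSet ∧ (A.verts ∩ B.verts).ncard = k

/-- Internally 3-connected: (simple and) 2-connected, and in every separation of order two, one of
the sides has at most two edges. -/
def IsInternallyThreeConnected {V : Type*} (G : SimpleGraph V) : Prop :=
  G.IsVertexConnected 2 ∧ ∀ A B : G.Subgraph, IsSeparation A B 2 →
    A.edgeSet.ncard ≤ 2 ∨ B.edgeSet.ncard ≤ 2

/-- A combinatorial embedding of `G` in an oriented surface: around every vertex, a cyclic order of
the darts (oriented edges) that leave it. -/
structure RotationSystem {V : Type*} (G : SimpleGraph V) where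
  /-- the next dart around the same initial vertex -/
  rot : Equiv.Perm G.Dart
  rot_fst : ∀ d, (rot d).fst = d.fst
  sameCycle : ∀ d e : G.Dart, d.fst = e.fst → rot.SameCycle d e

namespace RotationSystem

variable {V : Type*} {G : SimpleGraph V}

/-- The face-tracing permutation: traverse a dart, then turn into the next dart around its head. -/
def facePerm (R : RotationSystem G) : Equiv.Perm G.Dart :=
  (Function.Involutive.toPerm Dart.symm Dart.symm_involutive).trans R.rot

/-- The faces of the embedding (of a connected graph with an edge): the orbits of the face-tracing
permutation. -/
def Face (R : RotationSystem G) : Type _ :=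
  Quotient (Equiv.Perm.SameCycle.setoid R.facePerm)

/-- The face on a fixed side of a dart. The edge of `d` lies on the boundary of `R.face d` and of
`R.face d.symm`. -/
def face (R : RotationSystem G) (d : G.Dart) : R.Face :=
  Quotient.mk _ d

/-- A vertex is incident with a face if the boundary walk of the face passes through it. -/
def Incident (R : RotationSystem G) (x : V) (F : R.Face) : Prop :=
  ∃ d : G.Dart, d.fst = x ∧ R.face d = F

/-- The embedding has genus zero, by Euler's formula, each component being counted on a sphere of its
own. An isolated vertex has no darts, so the one face around it is counted separately. -/
def IsPlane (R : RotationSystem G) : Prop :=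
  Nat.card V + (Nat.card R.Face + {x : V | ∀ y, ¬ G.Adj x y}.ncard) =
    G.edgeSet.ncard + 2 * Nat.card G.ConnectedComponent

/-- `R.IsDualWalk F l F'`: `l` is a walk from `F` to `F'` in the dual (multi)graph. The vertices of
the dual are the faces, and the dual of the edge of a dart `d` joins `R.face d` to `R.face d.symm`;
traversing it in this direction is recorded by `d`. -/
def IsDualWalk (R : RotationSystem G) : R.Face → List G.Dart → R.Face → Prop
  | F, [], F' => F = F'
  | F, d :: l, F' => R.face d = F ∧ R.IsDualWalk (R.face d.symm) l F'

/-- A dual path is a dual walk that visits no face twice. -/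
def IsDualPath (R : RotationSystem G) (F : R.Face) (l : List G.Dart) (F' : R.Face) : Prop :=
  R.IsDualWalk F l F' ∧ (F :: l.map fun d => R.face d.symm).Nodup

/-- The length of a dual walk, where the dual of an edge `e` has the weight `w e`. -/
def dualLength (w : Sym2 V → ℕ) (l : List G.Dart) : ℕ :=
  (l.map fun d => w d.edge).sum

/-- The distance between two faces in the weighted dual graph. -/
noncomputable def faceDist (R : RotationSystem G) (w : Sym2 V → ℕ) (F F' : R.Face) : ℕ :=
  sInf {n | ∃ l, R.IsDualWalk F l F' ∧ dualLength w l = n}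

/-- The distance from a vertex `x` to a face `F`: the least distance to `F` from a face that is
incident with `x`. -/
noncomputable def vertexDist (R : RotationSystem G) (w : Sym2 V → ℕ) (x : V) (F : R.Face) : ℕ :=
  sInf {n | ∃ F', R.Incident x F' ∧ R.faceDist w F' F = n}

/-- The weights are balanced between `F` and `F'` if the dual of every edge lies on a shortest dual
path from `F` to `F'`. -/
def IsBalanced (R : RotationSystem G) (w : Sym2 V → ℕ) (F F' : R.Face) : Prop :=
  ∀ e ∈ G.edgeSet, ∃ l : List G.Dart, R.IsDualPath F l F' ∧
    dualLength w l = R.faceDist w F F' ∧ ∃ d ∈ l, d.edge = e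

theorem pow_rot_fst (R : RotationSystem G) (n : ℕ) (d : G.Dart) :
    ((R.rot ^ n) d).fst = d.fst := by
  induction n with
  | zero => rfl
  | succ n ih => rw [pow_succ', Equiv.Perm.mul_apply, R.rot_fst, ih]

section Restrict

variable {W : Type*} {K : SimpleGraph W}

/-- The dart of the larger graph that corresponds to a dart of the smaller one. -/
def dartMap (f : Copy K G) (d : K.Dart) : G.Dart := f.toHom.mapDart d

theorem dartMap_injective (f : Copy K G) : Function.Injective (dartMap f) := by
  intro d e h
  have h1 : f.toHom d.fst = f.toHom e.fst := congrArg (fun x : G.Dart => x.fst) h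
  have h2 : f.toHom d.snd = f.toHom e.snd := congrArg (fun x : G.Dart => x.snd) h
  exact Dart.ext _ _ (Prod.ext (f.injective h1) (f.injective h2))

variable [Finite V]

theorem finite_dart : Finite G.Dart :=
  Finite.of_injective (fun d : G.Dart => d.toProd) (fun _ _ h => Dart.ext _ _ h)

theorem exists_return (R : RotationSystem G) (f : Copy K G) (d : K.Dart) :
    ∃ n, 0 < n ∧ ∃ d' : K.Dart, (R.rot ^ n) (dartMap f d) = dartMap f d' := by
  have := finite_dart (G := G)
  exact ⟨orderOf R.rot, orderOf_pos _, d, by rw [pow_orderOf_eq_one]; rfl⟩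

open Classical in
/-- How many steps of the rotation lead from a dart of the subgraph to the next one. -/
noncomputable def returnTime (R : RotationSystem G) (f : Copy K G) (d : K.Dart) : ℕ :=
  Nat.find (R.exists_return f d)

theorem returnTime_pos (R : RotationSystem G) (f : Copy K G) (d : K.Dart) :
    0 < R.returnTime f d := by
  classical exact (Nat.find_spec (R.exists_return f d)).1

theorem returnTime_le (R : RotationSystem G) (f : Copy K G) (d d' : K.Dart) (n : ℕ) (hn : 0 < n)
    (h : (R.rot ^ n) (dartMap f d) = dartMap f d') : R.returnTime f d ≤ n := by
  classical exact Nat.find_min' (R.exists_return f d) ⟨hn, d', h⟩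

theorem exists_next (R : RotationSystem G) (f : Copy K G) (d : K.Dart) :
    ∃ d' : K.Dart, (R.rot ^ R.returnTime f d) (dartMap f d) = dartMap f d' := by
  classical exact (Nat.find_spec (R.exists_return f d)).2

/-- The first dart of the subgraph that follows `d` in the rotation of the larger graph. -/
noncomputable def next (R : RotationSystem G) (f : Copy K G) (d : K.Dart) : K.Dart :=
  (R.exists_next f d).choose

theorem next_spec (R : RotationSystem G) (f : Copy K G) (d : K.Dart) :
    (R.rot ^ R.returnTime f d) (dartMap f d) = dartMap f (R.next f d) :=
  (R.exists_next f d).choose_spec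

theorem next_injective (R : RotationSystem G) (f : Copy K G) : Function.Injective (R.next f) := by
  have key : ∀ d e, R.next f d = R.next f e → R.returnTime f d ≤ R.returnTime f e → d = e := by
    intro d e h hle
    have h1 := R.next_spec f d
    rw [h, ← R.next_spec f e] at h1
    obtain ⟨k, hk⟩ := Nat.exists_eq_add_of_le hle
    rw [hk, pow_add, Equiv.Perm.mul_apply] at h1
    have h2 := (R.rot ^ R.returnTime f d).injective h1
    rcases Nat.eq_zero_or_pos k with h0 | h0
    · subst h0
      exact dartMap_injective f h2
    · have h3 := R.returnTime_le f e d k h0 h2.symm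
      have h4 := R.returnTime_pos f d
      omega
  intro d e h
  rcases le_total (R.returnTime f d) (R.returnTime f e) with hle | hle
  · exact key d e h hle
  · exact (key e d h.symm hle).symm

theorem next_bijective (R : RotationSystem G) (f : Copy K G) : Function.Bijective (R.next f) := by
  have := finite_dart (G := G)
  have := Finite.of_injective _ (dartMap_injective f)
  exact Finite.injective_iff_bijective.mp (R.next_injective f)

/-- The embedding of a subgraph that is induced by an embedding of the whole graph: around each
vertex, the remaining darts keep their cyclic order. -/
noncomputable def restrict (R : RotationSystem G) (f : Copy K G) : RotationSystem K where
  rot := Equiv.ofBijective (R.next f) (R.next_bijective f)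
  rot_fst d := by
    have h := congrArg (fun x : G.Dart => x.fst) (R.next_spec f d)
    simp only [pow_rot_fst] at h
    exact (f.injective h).symm
  sameCycle d e hde := by
    have := finite_dart (G := G)
    have hs : R.rot.SameCycle (dartMap f d) (dartMap f e) :=
      R.sameCycle _ _ (congrArg f.toHom hde)
    obtain ⟨k, hk⟩ := hs.exists_nat_pow_eq
    clear hde hs
    induction k using Nat.strong_induction_on generalizing d with
    | _ k ih =>
      rcases Nat.eq_zero_or_pos k with h0 | h0
      · subst h0
        rw [dartMap_injective f hk]
      · obtain ⟨j, hj⟩ := Nat.exists_eq_add_of_le (R.returnTime_le f d e k h0 hk)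
        have hp := R.returnTime_pos f d
        rw [hj, add_comm, pow_add, Equiv.Perm.mul_apply, R.next_spec f d] at hk
        have h1 := ih j (by omega) (R.next f d) hk
        refine Equiv.Perm.SameCycle.trans ?_ h1
        exact ⟨1, rfl⟩

end Restrict

end RotationSystem

/-- A graph is planar if it has a combinatorial embedding of genus zero. -/
def IsPlanar {V : Type*} (G : SimpleGraph V) : Prop :=
  ∃ R : RotationSystem G, R.IsPlane

/-- `G - {u, v}` as a subgraph of `G - uv`. -/
def deleteEndsCopy {V : Type*} (G : SimpleGraph V) (u v : V) :
    Copy (G.induce {u, v}ᶜ) (G.deleteEdges {s(u, v)}) where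
  toHom :=
    { toFun := Subtype.val
      map_rel' := by
        intro x y h
        refine deleteEdges_adj.mpr ⟨h, fun he => ?_⟩
        have hx : (x : V) ∈ s(u, v) := by
          rw [← Set.mem_singleton_iff.mp he]
          exact Sym2.mem_mk_left _ _
        rcases Sym2.mem_iff.mp hx with h1 | h1
        · exact x.2 (Or.inl h1)
        · exact x.2 (Or.inr h1) }
  injective' := Subtype.val_injective

end SimpleGraph

/-! ### Face tracing, cycles of permutations, and induction along edges -/

namespace SimpleGraph
namespace RotationSystem

variable {V : Type*} {G : SimpleGraph V}

/-! Write `K` for `G - {u, v}`. All topology is replaced by linear algebra on darts. Coboundaries of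
vertex functions are orthogonal to boundaries of face functions. For a connected graph the two
together span a space of dimension at least `|V| + |F| - 2` inside the antisymmetric functions,
whose dimension is at most `|E|`. This is Euler's inequality for every orientable surface
(`card_add_card_face_le`). For a plane embedding the span is everything, so an antisymmetric
function with zero sum along every face is a coboundary (`IsPlane.exists_potential`), which serves
as a discrete Jordan curve theorem.

If `u` and `v` had a common face in `G - uv`, then `uv` could be drawn inside it; nonplanarity
forbids this. They have no common neighbour either, as such a vertex would have degree at most one
in `K`. Hence deleting `u` merges the faces around it into a single face `F_u` incident with all
`u_i`, likewise for `v`, and an Euler count shows that the induced embedding of `K` is plane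
(`EndsApart`). The `u_i` and `v_i` have degree two in `K`. If two vertices of degree two shared two
faces, a potential would show that an edge at one and an edge at the other form a cut, and the two
vertices would give a separation with more than two edges on each side
(`IsPlane.face_eq_of_incident`). So `F_u` is unique, and the second faces `U_i` at the `u_i` are
distinct.

The dual of `K` has no cut vertex, so it has an st-numbering from `F_u` to `F_v`. Give each edge the
difference of the numbers of its two faces: the shortest paths from `F_u` to `F_v` are then the
increasing ones, and every edge lies on one, which is condition 1. With these weights fixed,
conditions 3 and 4 ask for ratios `α_j = ω(uu_j) / ω(uv)` that satisfy covering inequalities, with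
each `α_j` occurring in some tight one. The coefficient of `α_j` vanishes only at `F_u` and `U_j`,
so such ratios can be chosen one after another (`exists_tight_coefficients`). One common denominator
for both ends becomes `ω(uv)`. Finally the weights on `K` are multiplied by a large `k`: conditions
1 and 3 to 6 are homogeneous in them, while 2 and 7 hold once `k` is large. -/

theorem facePerm_apply (R : RotationSystem G) (d : G.Dart) : R.facePerm d = R.rot d.symm := rfl

theorem facePerm_fst (R : RotationSystem G) (d : G.Dart) : (R.facePerm d).fst = d.snd := by
  rw [facePerm_apply, R.rot_fst]; rfl

theorem face_eq_iff (R : RotationSystem G) {d e : G.Dart} :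
    R.face d = R.face e ↔ R.facePerm.SameCycle d e := Quotient.eq

theorem face_facePerm (R : RotationSystem G) (d : G.Dart) : R.face (R.facePerm d) = R.face d :=
  R.face_eq_iff.mpr (Equiv.Perm.SameCycle.symm ⟨1, rfl⟩)

theorem face_rot (R : RotationSystem G) (d : G.Dart) : R.face (R.rot d) = R.face d.symm := by
  have := R.face_facePerm d.symm
  rwa [facePerm_apply, Dart.symm_symm] at this

theorem face_surjective (R : RotationSystem G) : Function.Surjective R.face :=
  Quotient.mk_surjective

theorem finite_face [Finite V] (R : RotationSystem G) : Finite R.Face :=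
  have := finite_dart (G := G)
  Finite.of_surjective _ R.face_surjective

/-- A set that is mapped into itself by a permutation of a finite type contains, with every point,
its whole cycle. -/
theorem mem_of_sameCycle {α : Type*} [Finite α] {σ : Equiv.Perm α} {s : Set α}
    (hs : ∀ x ∈ s, σ x ∈ s) {x y : α} (h : σ.SameCycle x y) (hx : x ∈ s) : y ∈ s := by
  obtain ⟨n, rfl⟩ := h.exists_nat_pow_eq
  induction n with
  | zero => exact hx
  | succ n ih =>
    rw [pow_succ', Equiv.Perm.mul_apply]
    exact hs _ (ih ⟨n, rfl⟩)

/-- Two points of a cycle cut out an interval. -/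
theorem exists_interval {α : Type*} [Finite α] {σ : Equiv.Perm α} {d e : α}
    (h : σ.SameCycle d e) (hne : d ≠ e) : ∃ I : Set α, d ∈ I ∧ e ∉ I ∧
      (∀ y ∈ I, σ.SameCycle d y) ∧ (∀ y, σ y = d → y ∉ I) ∧ (∀ y, σ y = e → y ∈ I) ∧
      ∀ y, σ y ≠ d → σ y ≠ e → (σ y ∈ I ↔ y ∈ I) := by
  classical
  have hex := h.exists_nat_pow_eq
  set m := Nat.find hex with hm
  have hme : (σ ^ m) d = e := Nat.find_spec hex
  have hmin : ∀ i < m, (σ ^ i) d ≠ e := fun i hi => Nat.find_min hex hi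
  have hmpos : 0 < m := by
    rcases Nat.eq_zero_or_pos m with h0 | h0
    · rw [h0] at hme; exact absurd hme hne
    · exact h0
  -- The half-open arc from `d` up to, but excluding, the first occurrence of `e`. Its indicator
  -- changes along `σ` only on entering `d` and on entering `e`.
  refine ⟨{y | ∃ i < m, (σ ^ i) d = y}, ⟨0, hmpos, rfl⟩, fun ⟨i, hi, h⟩ => hmin i hi h, ?_, ?_,
    ?_, fun y hyd hye => ⟨?_, ?_⟩⟩
  · rintro _ ⟨i, _, rfl⟩
    exact ⟨i, rfl⟩
  · rintro y hy ⟨i, hi, rfl⟩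
    have hper : (σ ^ (i + 1)) d = d := by rw [pow_succ']; exact hy
    refine hmin (m - (i + 1)) (by omega) ?_
    rw [← hme]
    conv_rhs => rw [show m = (m - (i + 1)) + (i + 1) by omega, pow_add, Equiv.Perm.mul_apply, hper]
  · intro y hy
    refine ⟨m - 1, by omega, σ.injective ?_⟩
    rw [hy, ← hme, ← Equiv.Perm.mul_apply, ← pow_succ', Nat.sub_add_cancel hmpos]
  · rintro ⟨i, hi, h⟩
    cases i with
    | zero => exact absurd h.symm hyd
    | succ i =>
      rw [pow_succ'] at h
      exact ⟨i, by omega, σ.injective h⟩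
  · rintro ⟨i, hi, rfl⟩
    refine ⟨i + 1, lt_of_le_of_ne hi fun h => hye ?_, by rw [pow_succ']; rfl⟩
    rw [← hme, ← h, pow_succ']; rfl

/-- Induction along the edges of a connected graph. -/
theorem forall_of_adj (hc : G.Connected) {P : V → Prop} {x : V} (hx : P x)
    (h : ∀ y z, G.Adj y z → P y → P z) (y : V) : P y := by
  obtain ⟨w⟩ := hc.preconnected x y
  induction w with
  | nil => exact hx
  | cons hadj _ ih => exact ih (h _ _ hadj hx)

theorem forall_dart_of_connected [Finite V] (R : RotationSystem G) (hc : G.Connected)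
    {P : G.Dart → Prop} {d : G.Dart} (hd : P d) (hsymm : ∀ d, P d → P d.symm)
    (hrot : ∀ d, P d → P (R.rot d)) (e : G.Dart) : P e := by
  have := finite_dart (G := G)
  have star : ∀ d e : G.Dart, d.fst = e.fst → P d → P e := fun d e h hd =>
    mem_of_sameCycle (s := {d | P d}) hrot (R.sameCycle d e h) hd
  refine forall_of_adj hc (P := fun x => ∀ e : G.Dart, e.fst = x → P e) (x := d.fst)
    (fun e he => star d e he.symm hd) ?_ e.fst e rfl
  intro y z hyz hy e he
  exact star _ e he.symm (hsymm _ (hy ⟨(y, z), hyz⟩ rfl))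

/-! ### Discrete Hodge theory, Euler's inequality, and potentials on the sphere -/

section Homology

variable (R : RotationSystem G)

/-- The coboundary of a vertex function plus the boundary of a face function. -/
def hodgeMap : (V → ℝ) × (R.Face → ℝ) →ₗ[ℝ] (G.Dart → ℝ) where
  toFun x d := (x.1 d.snd - x.1 d.fst) + (x.2 (R.face d) - x.2 (R.face d.symm))
  map_add' x y := by ext d; simp only [Prod.fst_add, Prod.snd_add, Pi.add_apply]; ring
  map_smul' c x := by
    ext d
    simp only [Prod.smul_fst, Prod.smul_snd, Pi.smul_apply, smul_eq_mul, RingHom.id_apply]; ring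

/-- The functions on darts that change sign when a dart is reversed. -/
def antisymm (G : SimpleGraph V) : Submodule ℝ (G.Dart → ℝ) where
  carrier := {z | ∀ d, z d.symm = - z d}
  add_mem' ha hb d := by
    simp only [Set.mem_ofPred_eq] at ha hb
    simp only [Pi.add_apply, ha, hb]; ring
  zero_mem' d := by simp
  smul_mem' c z hz d := by
    simp only [Set.mem_ofPred_eq] at hz
    simp only [Pi.smul_apply, hz, smul_eq_mul]; ring

theorem hodgeMap_range_le : LinearMap.range R.hodgeMap ≤ antisymm G := by
  rintro _ ⟨x, rfl⟩ d
  change (x.1 d.fst - x.1 d.snd) + (x.2 (R.face d.symm) - x.2 (R.face d.symm.symm)) =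
    -((x.1 d.snd - x.1 d.fst) + (x.2 (R.face d) - x.2 (R.face d.symm)))
  rw [Dart.symm_symm]; ring

theorem finrank_antisymm_le [Finite V] :
    Module.finrank ℝ (antisymm G) ≤ G.edgeSet.ncard := by
  classical
  have hex : ∀ e : G.edgeSet, ∃ d : G.Dart, d.edge = e := by
    rintro ⟨e, he⟩
    induction e with
    | _ x y => exact ⟨⟨(x, y), he⟩, rfl⟩
  choose o ho using hex
  let f : antisymm G →ₗ[ℝ] (G.edgeSet → ℝ) :=
    { toFun := fun z e => z.1 (o e)
      map_add' := fun _ _ => rfl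
      map_smul' := fun _ _ => rfl }
  have hf : Function.Injective f := by
    rw [← LinearMap.ker_eq_bot, LinearMap.ker_eq_bot']
    intro z hz
    ext d
    have h : z.1 (o ⟨d.edge, d.edge_mem⟩) = 0 := congrFun hz ⟨d.edge, d.edge_mem⟩
    rcases dart_edge_eq_iff _ _ |>.mp (ho ⟨d.edge, d.edge_mem⟩) with h' | h'
    · rw [h'] at h; exact h
    · rw [h', z.2 d, neg_eq_zero] at h; exact h
  have : Fintype G.edgeSet := Fintype.ofFinite _
  have h := LinearMap.finrank_le_finrank_of_injective hf
  rwa [Module.finrank_fintype_fun_eq_card, ← Nat.card_eq_fintype_card] at h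

theorem not_isolated_of_connected [Nonempty G.Dart] (hc : G.Connected) :
    {x : V | ∀ y, ¬ G.Adj x y} = ∅ := by
  rw [Set.eq_empty_iff_forall_notMem]
  intro x hx
  obtain ⟨d⟩ := ‹Nonempty G.Dart›
  refine forall_of_adj hc (P := fun y => ∃ z, G.Adj y z) (x := d.fst) ⟨_, d.adj⟩
    (fun y z h _ => ⟨y, h.symm⟩) x |>.elim hx

theorem isPlane_iff_of_connected [Nonempty G.Dart] (hc : G.Connected) :
    R.IsPlane ↔ Nat.card V + Nat.card R.Face = G.edgeSet.ncard + 2 := by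
  have h1 : Nat.card G.ConnectedComponent = 1 := by
    have := hc.preconnected.subsingleton_connectedComponent
    have := hc.nonempty.map G.connectedComponentMk
    exact Nat.card_unique
  rw [IsPlane, h1, not_isolated_of_connected hc, Set.ncard_empty, add_zero, mul_one]

variable [Fintype G.Dart]

theorem sum_dart_symm (f : G.Dart → ℝ) : ∑ d : G.Dart, f d.symm = ∑ d, f d :=
  Equiv.sum_comp (Function.Involutive.toPerm Dart.symm Dart.symm_involutive) f

/-- Face tracing keeps the face and moves to the head of the dart, so the sum telescopes around each
face. -/
theorem sum_coboundary_mul_face (q : V → ℝ) (p : R.Face → ℝ) :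
    ∑ d : G.Dart, (q d.snd - q d.fst) * p (R.face d) = 0 := by
  have h := Equiv.sum_comp R.facePerm (fun d : G.Dart => q d.fst * p (R.face d))
  simp only [facePerm_fst, face_facePerm] at h
  simp only [sub_mul, Finset.sum_sub_distrib, h, sub_self]

theorem sum_coboundary_mul_boundary (q : V → ℝ) (p : R.Face → ℝ) :
    ∑ d : G.Dart, (q d.snd - q d.fst) * (p (R.face d) - p (R.face d.symm)) = 0 := by
  have h := sum_dart_symm (fun d : G.Dart => (q d.snd - q d.fst) * p (R.face d))
  rw [sum_coboundary_mul_face] at h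
  have h' : ∑ d : G.Dart, (q d.snd - q d.fst) * p (R.face d.symm) = 0 := by
    rw [← neg_eq_zero, ← Finset.sum_neg_distrib, ← h]
    refine Finset.sum_congr rfl fun d _ => ?_
    change _ = (q d.fst - q d.snd) * p (R.face d.symm)
    ring
  simp only [mul_sub, Finset.sum_sub_distrib, h', sum_coboundary_mul_face, sub_self]

/-- If the coboundary and the boundary cancel, the coboundary is orthogonal to itself, so both
vanish. -/
theorem eq_zero_of_hodgeMap_eq_zero {x : (V → ℝ) × (R.Face → ℝ)} (hx : R.hodgeMap x = 0)
    (d : G.Dart) : x.1 d.snd = x.1 d.fst ∧ x.2 (R.face d) = x.2 (R.face d.symm) := by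
  have h0 : ∀ d : G.Dart,
      (x.1 d.snd - x.1 d.fst) + (x.2 (R.face d) - x.2 (R.face d.symm)) = 0 :=
    fun d => congrFun hx d
  have h1 : ∑ d : G.Dart, (x.1 d.snd - x.1 d.fst) ^ 2 = 0 := by
    rw [← neg_eq_zero, ← Finset.sum_neg_distrib, ← R.sum_coboundary_mul_boundary x.1 x.2]
    refine Finset.sum_congr rfl fun d _ => ?_
    rw [eq_neg_of_add_eq_zero_right (h0 d)]; ring
  have h2 := (Finset.sum_eq_zero_iff_of_nonneg fun d _ => sq_nonneg _).mp h1 d (Finset.mem_univ d)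
  have h3 : x.1 d.snd - x.1 d.fst = 0 := pow_eq_zero_iff two_ne_zero |>.mp h2
  have h4 := h0 d
  rw [h3, zero_add] at h4
  exact ⟨sub_eq_zero.mp h3, sub_eq_zero.mp h4⟩

/-- On a connected graph the kernel of `hodgeMap` consists of pairs of constants: a vertex function
is constant along edges, and a face function is constant across edges. So it is determined by two
values, and rank-nullity applies. -/
theorem card_add_card_face_le_finrank_range [Finite V] [Nonempty G.Dart] (hc : G.Connected) :
    Nat.card V + Nat.card R.Face ≤ Module.finrank ℝ (LinearMap.range R.hodgeMap) + 2 := by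
  classical
  have := R.finite_face
  have : Fintype V := Fintype.ofFinite V
  have : Fintype R.Face := Fintype.ofFinite _
  obtain ⟨d₀⟩ := ‹Nonempty G.Dart›
  have h1 := LinearMap.finrank_range_add_finrank_ker R.hodgeMap
  rw [Module.finrank_prod, Module.finrank_fintype_fun_eq_card,
    Module.finrank_fintype_fun_eq_card, ← Nat.card_eq_fintype_card,
    ← Nat.card_eq_fintype_card] at h1
  let f : LinearMap.ker R.hodgeMap →ₗ[ℝ] ℝ × ℝ :=
    { toFun := fun x => (x.1.1 d₀.fst, x.1.2 (R.face d₀))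
      map_add' := fun _ _ => rfl
      map_smul' := fun _ _ => rfl }
  have hf : Function.Injective f := by
    rw [← LinearMap.ker_eq_bot, LinearMap.ker_eq_bot']
    rintro ⟨⟨q, p⟩, hx⟩ hz
    have hd := R.eq_zero_of_hodgeMap_eq_zero (LinearMap.mem_ker.mp hx)
    have hq0 : q d₀.fst = 0 := congrArg Prod.fst hz
    have hp0 : p (R.face d₀) = 0 := congrArg Prod.snd hz
    have hq : ∀ y, q y = 0 := forall_of_adj hc hq0 fun y z hyz hy =>
      ((hd ⟨(y, z), hyz⟩).1).trans hy
    have hp : ∀ d, p (R.face d) = 0 := R.forall_dart_of_connected hc hp0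
      (fun d h => (hd d).2.symm.trans h)
      (fun d h => by rw [face_rot]; exact (hd d).2.symm.trans h)
    refine Subtype.ext (Prod.ext (funext hq) (funext fun F => ?_))
    obtain ⟨d, rfl⟩ := R.face_surjective F
    exact hp d
  have h2 := LinearMap.finrank_le_finrank_of_injective hf
  rw [Module.finrank_prod, Module.finrank_self] at h2
  omega

/-- The Euler inequality for combinatorial embeddings in orientable surfaces. -/
theorem card_add_card_face_le [Finite V] [Nonempty G.Dart] (hc : G.Connected) :
    Nat.card V + Nat.card R.Face ≤ G.edgeSet.ncard + 2 := by
  refine (R.card_add_card_face_le_finrank_range hc).trans ?_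
  have := Submodule.finrank_mono R.hodgeMap_range_le
  have := finrank_antisymm_le (G := G)
  omega

open Classical in
/-- On the sphere, an antisymmetric function on the darts that sums to zero along every face is the
coboundary of a function on the vertices. -/
theorem IsPlane.exists_potential [Finite V] [Nonempty G.Dart] {R : RotationSystem G}
    (hR : R.IsPlane) (hc : G.Connected) {z : G.Dart → ℝ} (hz : ∀ d, z d.symm = - z d)
    (hF : ∀ F, ∑ d with R.face d = F, z d = 0) :
    ∃ q : V → ℝ, ∀ d : G.Dart, z d = q d.snd - q d.fst := by
  have := R.finite_face
  have : Fintype R.Face := Fintype.ofFinite _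
  rw [isPlane_iff_of_connected R hc] at hR
  -- Genus zero squeezes the rank between `|V| + |F| - 2 = |E|` and the dimension of the
  -- antisymmetric functions.
  have heq : LinearMap.range R.hodgeMap = antisymm G := by
    refine Submodule.eq_of_le_of_finrank_le R.hodgeMap_range_le ?_
    have := R.card_add_card_face_le_finrank_range hc
    have := finrank_antisymm_le (G := G)
    omega
  obtain ⟨⟨q, p⟩, hqp⟩ : z ∈ LinearMap.range R.hodgeMap := heq ▸ hz
  have hd : ∀ d : G.Dart,
      z d = (q d.snd - q d.fst) + (p (R.face d) - p (R.face d.symm)) :=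
    fun d => (congrFun hqp d).symm
  have hzp : ∑ d, z d * p (R.face d) = 0 := by
    rw [← Finset.sum_fiberwise (s := Finset.univ) (g := R.face)]
    refine Finset.sum_eq_zero fun F _ => ?_
    rw [← zero_mul (p F), ← hF F, Finset.sum_mul]
    refine Finset.sum_congr rfl fun d hd => ?_
    rw [(Finset.mem_filter.mp hd).2]
  have hzp' : ∑ d, z d * p (R.face d.symm) = 0 := by
    rw [← neg_eq_zero, ← Finset.sum_neg_distrib, ← hzp, ← sum_dart_symm]
    refine Finset.sum_congr rfl fun d _ => ?_
    rw [hz d, Dart.symm_symm]; ring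
  -- Both `z` and the coboundary of `q` are orthogonal to the boundary of `p`; so is their
  -- difference, which is that boundary itself.
  have h1 : ∑ d : G.Dart, (p (R.face d) - p (R.face d.symm)) ^ 2 = 0 := by
    have h2 : ∑ d : G.Dart, z d * (p (R.face d) - p (R.face d.symm)) = 0 := by
      simp only [mul_sub, Finset.sum_sub_distrib, hzp, hzp', sub_self]
    have h3 := R.sum_coboundary_mul_boundary q p
    rw [← sub_eq_zero.mpr (h2.trans h3.symm), ← Finset.sum_sub_distrib]
    refine Finset.sum_congr rfl fun d _ => ?_
    rw [hd d]; ring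
  refine ⟨q, fun d => ?_⟩
  have h2 := (Finset.sum_eq_zero_iff_of_nonneg fun d _ => sq_nonneg _).mp h1 d (Finset.mem_univ d)
  rw [hd d, pow_eq_zero_iff two_ne_zero |>.mp h2, add_zero]

end Homology

end RotationSystem
end SimpleGraph

/-! ### Plane 2-connected graphs: simple face boundaries and a dual without cut vertices -/

namespace SimpleGraph

variable {V : Type*} {G : SimpleGraph V}

theorem IsVertexConnected.mono {j k : ℕ} (h : G.IsVertexConnected k) (hjk : j ≤ k) :
    G.IsVertexConnected j :=
  ⟨hjk.trans_lt h.1, fun S hS => h.2 S (hS.trans_le hjk)⟩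

theorem IsVertexConnected.connected {k : ℕ} (h : G.IsVertexConnected k) (hk : 0 < k) :
    G.Connected := by
  have h0 := h.2 ∅ (by simpa using hk)
  rw [Set.compl_empty] at h0
  exact (induceUnivIso G).connected_iff.mp h0

/-- Induction along the edges of a 2-connected graph that avoid a given vertex. -/
theorem IsVertexConnected.forall_of_adj_of_ne (h : G.IsVertexConnected 2) {x : V} {P : V → Prop}
    {y : V} (hyx : y ≠ x) (hy : P y)
    (hP : ∀ y z, y ≠ x → z ≠ x → G.Adj y z → P y → P z) {z : V} (hzx : z ≠ x) : P z := by
  have hc := h.2 {x} (by simp)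
  exact RotationSystem.forall_of_adj hc (P := fun a => P a.1) (x := ⟨y, hyx⟩) hy
    (fun a b hab ha => hP a b a.2 b.2 hab ha) ⟨z, hzx⟩

theorem IsVertexConnected.exists_adj_ne [Finite V] (h : G.IsVertexConnected 2) (x y : V) :
    ∃ z, z ≠ y ∧ G.Adj x z := by
  by_contra! hno
  obtain ⟨w, hwx, hwy⟩ : ∃ w, w ≠ x ∧ w ≠ y := by
    by_contra! hw
    have hsub : (Set.univ : Set V) ⊆ {x, y} := fun w _ => by
      by_cases hwx : w = x
      · exact Or.inl hwx
      · exact Or.inr (hw w hwx)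
    have := Set.ncard_le_ncard hsub
    rw [Set.ncard_univ] at this
    have := Set.ncard_insert_le x {y}
    rw [Set.ncard_singleton] at this
    have := h.1
    omega
  by_cases hxy : x = y
  · subst hxy
    refine hwx (RotationSystem.forall_of_adj (h.connected two_pos) (P := fun a => a = x)
      (x := x) rfl ?_ w)
    rintro a b hab rfl
    exact absurd hab (hno b hab.ne')
  · refine hwx (h.forall_of_adj_of_ne (x := y) (P := fun a => a = x) (y := x) hxy rfl ?_ hwy)
    rintro a b _ hb hab rfl
    exact absurd hab (hno b hb)

theorem IsVertexConnected.nonempty_dart [Finite V] (h : G.IsVertexConnected 2) :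
    Nonempty G.Dart := by
  obtain ⟨x⟩ := (h.connected two_pos).nonempty
  obtain ⟨z, _, hz⟩ := h.exists_adj_ne x x
  exact ⟨⟨(x, z), hz⟩⟩

namespace RotationSystem

open Classical in
theorem sum_face_single_sub [Fintype G.Dart] (R : RotationSystem G) (c c' : G.Dart)
    (F : R.Face) :
    ∑ y with R.face y = F, ((if y = c then (1 : ℝ) else 0) - (if y = c' then 1 else 0)) =
      (if R.face c = F then 1 else 0) - (if R.face c' = F then 1 else 0) := by
  have h3 : ∀ c : G.Dart, ∑ y with R.face y = F, (if y = c then (1 : ℝ) else 0) =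
      if R.face c = F then 1 else 0 := by
    intro c
    rw [Finset.sum_filter, Finset.sum_eq_single c]
    · simp
    · intro b _ hb; simp [hb]
    · simp
  rw [Finset.sum_sub_distrib, h3, h3]

variable [Finite V] {R : RotationSystem G}

open Classical in
/-- A face-balanced function that is supported on the star of a vertex is constant there. -/
theorem IsPlane.eq_of_supported_on_star [Fintype G.Dart] (hR : R.IsPlane)
    (h2 : G.IsVertexConnected 2) {z : G.Dart → ℝ} (hz : ∀ d, z d.symm = - z d)
    (hF : ∀ F, ∑ d with R.face d = F, z d = 0) {x : V}
    (hx : ∀ d : G.Dart, d.fst ≠ x → d.snd ≠ x → z d = 0) {d e : G.Dart}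
    (hd : d.fst = x) (he : e.fst = x) : z d = z e := by
  have := h2.nonempty_dart
  obtain ⟨q, hq⟩ := hR.exists_potential (h2.connected two_pos) hz hF
  -- Off the star the potential does not change, and the graph without `x` is connected, so `q` is
  -- constant on the vertices other than `x`.
  have hde : q e.snd = q d.snd := by
    refine h2.forall_of_adj_of_ne (x := x) (P := fun y => q y = q d.snd) (y := d.snd)
      (hd ▸ d.adj.ne') rfl ?_ (he ▸ e.adj.ne')
    intro y z hy hz hyz h
    have h0 := hx ⟨(y, z), hyz⟩ hy hz
    rw [hq] at h0
    exact (sub_eq_zero.mp h0).trans h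
  rw [hq, hq, hde, hd, he]

/-- The boundary walk of a face of a 2-connected plane graph passes through a vertex at most once. -/
theorem IsPlane.dart_eq_of_face_eq (hR : R.IsPlane) (h2 : G.IsVertexConnected 2) {d e : G.Dart}
    (hfst : d.fst = e.fst) (hface : R.face d = R.face e) : d = e := by
  classical
  have := finite_dart (G := G)
  have : Fintype G.Dart := Fintype.ofFinite _
  by_contra hne
  obtain ⟨I, hdI, heI, hIcyc, hId, hIe, hI⟩ := exists_interval (R.sameCycle d e hfst) hne
  have hIfst : ∀ y ∈ I, y.fst = d.fst := fun y hy =>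
    mem_of_sameCycle (s := {y : G.Dart | y.fst = d.fst}) (fun x hx => (R.rot_fst x).trans hx)
      (hIcyc y hy) rfl
  -- The arc `I` of the rotation from `d` to `e` is turned into a flow through the star. Along a
  -- face the sum of `χ y - χ y.symm` collects only the jumps of `χ`: `+1` at `d` and `-1` at `e`.
  -- They cancel as `d` and `e` lie on the same face, yet the flow is `1` on `d` and `0` on `e`.
  let χ : G.Dart → ℝ := fun y => if y ∈ I then 1 else 0
  have hχ : ∀ y, χ (R.rot y) - χ y =
      (if R.rot y = d then 1 else 0) - (if R.rot y = e then 1 else 0) := by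
    intro y
    by_cases h1 : R.rot y = d
    · simp [χ, h1, hId y h1, hdI, hne]
    · by_cases h3 : R.rot y = e
      · simp [χ, h3, hIe y h3, heI, Ne.symm hne]
      · simp [χ, h1, h3, hI y h1 h3]
  have key := hR.eq_of_supported_on_star h2 (z := fun y => χ y - χ y.symm) (x := d.fst)
    (d := d) (e := e) (fun y => by rw [Dart.symm_symm]; ring) ?_ ?_ rfl hfst.symm
  · have hd' : d.symm ∉ I := fun h => d.adj.ne' (hIfst _ h)
    have he' : e.symm ∉ I := fun h => e.adj.ne' ((hIfst _ h).trans hfst)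
    simp [χ, hdI, heI, hd', he'] at key
  · intro F
    have h1 : ∑ y with R.face y = F, χ y = ∑ y with R.face y = F, χ (R.facePerm y) := by
      rw [Finset.sum_filter, Finset.sum_filter,
        ← Equiv.sum_comp R.facePerm (fun y => if R.face y = F then χ y else 0)]
      simp only [face_facePerm]
    have h3 : ∀ c : G.Dart, ∑ y with R.face y = F, (if R.facePerm y = c then (1 : ℝ) else 0) =
        if R.face c = F then 1 else 0 := by
      intro c
      rw [Finset.sum_filter]
      have := Equiv.sum_comp R.facePerm
        (fun y => if R.face y = F then (if y = c then (1 : ℝ) else 0) else 0)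
      simp only [face_facePerm] at this
      rw [this, Finset.sum_eq_single c]
      · simp
      · intro b _ hb; simp [hb]
      · simp
    rw [Finset.sum_sub_distrib, h1, ← Finset.sum_sub_distrib,
      Finset.sum_congr rfl fun y _ => hχ y.symm, Finset.sum_sub_distrib]
    change (∑ y with R.face y = F, if R.facePerm y = d then (1 : ℝ) else 0) -
      (∑ y with R.face y = F, if R.facePerm y = e then (1 : ℝ) else 0) = 0
    rw [h3, h3, hface, sub_self]
  · intro y hy hy'
    have h1 : y ∉ I := fun h => hy (hIfst _ h)
    have h3 : y.symm ∉ I := fun h => hy' (hIfst _ h)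
    simp [χ, h1, h3]

/-- A 2-connected plane graph has different faces on the two sides of every edge. -/
theorem IsPlane.face_symm_ne (hR : R.IsPlane) (h2 : G.IsVertexConnected 2) (d : G.Dart) :
    R.face d.symm ≠ R.face d := by
  classical
  have := finite_dart (G := G)
  have : Fintype G.Dart := Fintype.ofFinite _
  intro hface
  obtain ⟨y, hy, hxy⟩ := h2.exists_adj_ne d.fst d.snd
  -- If both sides of `d` were the same face, unit flow along `d` alone would be balanced; but it
  -- vanishes on another dart at the same vertex.
  have key := hR.eq_of_supported_on_star h2
    (z := fun y => (if y = d then (1 : ℝ) else 0) - (if y = d.symm then 1 else 0)) (x := d.fst)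
    (d := d) (e := ⟨(d.fst, y), hxy⟩) (fun y => ?_) (fun F => ?_) ?_ rfl rfl
  · have h1 : (⟨(d.fst, y), hxy⟩ : G.Dart) ≠ d :=
      fun h => hy (congrArg (fun c : G.Dart => c.snd) h)
    have h3 : (⟨(d.fst, y), hxy⟩ : G.Dart) ≠ d.symm :=
      fun h => d.adj.ne (congrArg (fun c : G.Dart => c.fst) h)
    simp [h1, h3, d.symm_ne.symm] at key
  · have h1 : y.symm = d ↔ y = d.symm :=
      ⟨fun h => by rw [← h, Dart.symm_symm], fun h => by rw [h, Dart.symm_symm]⟩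
    have h3 : y.symm = d.symm ↔ y = d := Dart.symm_involutive.injective.eq_iff
    simp only [h1, h3]; ring
  · rw [sum_face_single_sub, hface, sub_self]
  · intro y hy hy'
    have h1 : y ≠ d := fun h => hy (by rw [h])
    have h3 : y ≠ d.symm := fun h => hy' (by rw [h]; rfl)
    simp [h1, h3]

/-- The dual graph, without multiplicities of edges. -/
def dualGraph (R : RotationSystem G) : SimpleGraph R.Face where
  Adj F F' := F ≠ F' ∧ ∃ d, R.face d = F ∧ R.face d.symm = F'
  symm := ⟨fun _ _ ⟨hne, d, h, h'⟩ => ⟨hne.symm, d.symm, h', by rwa [Dart.symm_symm]⟩⟩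
  loopless := ⟨fun _ h => h.1 rfl⟩

/-- Around a vertex of a 2-connected plane graph, the faces other than `X` form an interval. -/
theorem IsPlane.exists_base_dart (hR : R.IsPlane) (h2 : G.IsVertexConnected 2) {X : R.Face}
    {S : Set R.Face} (hS : ∀ F F', F ≠ X → F' ≠ X → R.dualGraph.Adj F F' → F ∈ S → F' ∈ S)
    (d₀ : G.Dart) : ∃ y₀ : G.Dart, ∀ d : G.Dart, d.fst = d₀.fst → R.face d ≠ X →
      (R.face d ∈ S ↔ R.face y₀ ∈ S) := by
  have := finite_dart (G := G)
  have step : ∀ y, R.face y ≠ X → R.face (R.rot y) ≠ X →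
      (R.face (R.rot y) ∈ S ↔ R.face y ∈ S) := by
    intro y hy hy'
    have hadj : R.dualGraph.Adj (R.face y) (R.face (R.rot y)) := by
      rw [face_rot]
      exact ⟨(hR.face_symm_ne h2 y).symm, y, rfl, rfl⟩
    exact ⟨hS _ _ hy' hy hadj.symm, hS _ _ hy hy' hadj⟩
  -- `X` occurs at most once around the vertex. Starting just behind it, the rotation reaches every
  -- other dart before it meets `X`, and consecutive faces are adjacent in the dual.
  obtain ⟨y₀, hy₀, hX⟩ : ∃ y₀ : G.Dart, y₀.fst = d₀.fst ∧
      ∀ y : G.Dart, y.fst = d₀.fst → R.face y = X → R.rot y = y₀ := by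
    by_cases hex : ∃ y : G.Dart, y.fst = d₀.fst ∧ R.face y = X
    · obtain ⟨y, hy, hyX⟩ := hex
      refine ⟨R.rot y, by rw [R.rot_fst, hy], fun y' hy' hyX' => ?_⟩
      rw [hR.dart_eq_of_face_eq h2 (hy.trans hy'.symm) (hyX.trans hyX'.symm)]
    · exact ⟨d₀, rfl, fun y hy hyX => (hex ⟨y, hy, hyX⟩).elim⟩
  refine ⟨y₀, fun d hd hdX => ?_⟩
  have hex := (R.sameCycle y₀ d (hy₀.trans hd.symm)).exists_nat_pow_eq
  classical
  set m := Nat.find hex with hm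
  have hmd : (R.rot ^ m) y₀ = d := Nat.find_spec hex
  have hmin : ∀ i < m, (R.rot ^ i) y₀ ≠ d := fun i hi => Nat.find_min hex hi
  have hnX : ∀ i ≤ m, R.face ((R.rot ^ i) y₀) ≠ X := by
    intro i hi hiX
    rcases hi.lt_or_eq with hi | rfl
    · have hper := hX _ ((R.pow_rot_fst i y₀).trans hy₀) hiX
      rw [← Equiv.Perm.mul_apply, ← pow_succ'] at hper
      refine hmin (m - (i + 1)) (by omega) ?_
      rw [← hmd]
      conv_rhs =>
        rw [show m = (m - (i + 1)) + (i + 1) by omega, pow_add, Equiv.Perm.mul_apply, hper]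
    · exact hdX (hmd ▸ hiX)
  have : ∀ i ≤ m, (R.face ((R.rot ^ i) y₀) ∈ S ↔ R.face y₀ ∈ S) := by
    intro i
    induction i with
    | zero => intro _; rfl
    | succ i ih =>
      intro hi
      have hs := step _ (hnX i (by omega)) (by
        rw [← Equiv.Perm.mul_apply, ← pow_succ']; exact hnX (i + 1) hi)
      rw [← Equiv.Perm.mul_apply, ← pow_succ'] at hs
      exact hs.trans (ih (by omega))
  rw [← hmd]
  exact this m le_rfl

/-- The dual of a 2-connected plane graph stays connected when a face is removed. -/
theorem IsPlane.forall_face_of_dualAdj (hR : R.IsPlane) (h2 : G.IsVertexConnected 2)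
    {X F₀ : R.Face} {S : Set R.Face} (hF₀ : F₀ ≠ X) (hF₀S : F₀ ∈ S)
    (hS : ∀ F F', F ≠ X → F' ≠ X → R.dualGraph.Adj F F' → F ∈ S → F' ∈ S) {F : R.Face}
    (hF : F ≠ X) : F ∈ S := by
  obtain ⟨d₀, rfl⟩ := R.face_surjective F₀
  obtain ⟨d, rfl⟩ := R.face_surjective F
  have star : ∀ e : G.Dart, (R.face e ≠ X ∧ R.face e ∈ S) → ∀ d : G.Dart, d.fst = e.fst →
      R.face d ≠ X → R.face d ∈ S := by
    intro e he d hd hdX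
    obtain ⟨y₀, hy₀⟩ := hR.exists_base_dart h2 hS e
    exact (hy₀ d hd hdX).mpr ((hy₀ e rfl he.1).mp he.2)
  refine forall_of_adj (h2.connected two_pos)
    (P := fun x => ∃ e : G.Dart, e.fst = x ∧ R.face e ≠ X ∧ R.face e ∈ S)
    ⟨d₀, rfl, hF₀, hF₀S⟩ ?_ d.fst |>.elim fun e he => star e he.2 d he.1.symm hF
  rintro x y hxy ⟨e, rfl, he⟩
  -- Membership in `S` is carried from one end of an edge to the other by a face beside the edge.
  -- Both of these faces are incident with both ends, and at most one of them is `X`.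
  let c : G.Dart := ⟨(e.fst, y), hxy⟩
  by_cases hc : R.face c.symm = X
  · have hc' : R.face c ≠ X := fun h => hR.face_symm_ne h2 c (hc.trans h.symm)
    refine ⟨R.facePerm c, R.facePerm_fst c, ?_⟩
    rw [face_facePerm]
    exact ⟨hc', star e he c rfl hc'⟩
  · refine ⟨c.symm, rfl, hc, ?_⟩
    rw [← face_rot] at hc ⊢
    exact star e he _ (R.rot_fst c) hc

end RotationSystem
end SimpleGraph

/-! ### Drawing an edge inside a face -/

namespace SimpleGraph
namespace RotationSystem

variable {V : Type*} {G : SimpleGraph V} {u v : V}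

/-- A dart of `G - uv` as a dart of `G`. -/
def dartOfDelete (u v : V) (d : (G.deleteEdges {s(u, v)}).Dart) : G.Dart :=
  (Hom.ofLE (deleteEdges_le {s(u, v)})).mapDart d

theorem dartOfDelete_injective : Function.Injective (dartOfDelete (G := G) u v) :=
  fun _ _ h => Dart.ext _ _ (congrArg (fun x : G.Dart => x.toProd) h)

theorem mem_range_dartOfDelete {y : G.Dart} :
    y ∈ Set.range (dartOfDelete (G := G) u v) ↔ y.edge ≠ s(u, v) := by
  constructor
  · rintro ⟨x, rfl⟩ h
    have := x.edge_mem
    rw [edgeSet_deleteEdges] at this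
    exact this.2 h
  · intro h
    refine ⟨⟨y.toProd, ?_⟩, rfl⟩
    exact deleteEdges_adj.mpr ⟨y.adj, h⟩

theorem eq_or_mem_range_dartOfDelete (huv : G.Adj u v) (y : G.Dart) :
    y = ⟨(u, v), huv⟩ ∨ y = ⟨(v, u), huv.symm⟩ ∨ ∃ x, dartOfDelete u v x = y := by
  by_cases h : y.edge = s(u, v)
  · rcases (dart_edge_eq_iff y ⟨(u, v), huv⟩).mp h with h | h
    · exact Or.inl h
    · exact Or.inr (Or.inl h)
  · exact Or.inr (Or.inr (mem_range_dartOfDelete.mpr h))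

/-- The rotation of `G - uv`, extended by fixed points and corrected so that `uv` precedes `d` and
`vu` precedes `e`. -/
theorem exists_insert_rot (M : (G.deleteEdges {s(u, v)}).RotationSystem) (huv : G.Adj u v)
    {d e : (G.deleteEdges {s(u, v)}).Dart} (hd : d.fst = u) (he : e.fst = v) :
    ∃ σ : Equiv.Perm G.Dart, σ ⟨(u, v), huv⟩ = dartOfDelete u v d ∧
      σ ⟨(v, u), huv.symm⟩ = dartOfDelete u v e ∧
      (∀ x, M.rot x = d → σ (dartOfDelete u v x) = ⟨(u, v), huv⟩) ∧
      (∀ x, M.rot x = e → σ (dartOfDelete u v x) = ⟨(v, u), huv.symm⟩) ∧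
      ∀ x, M.rot x ≠ d → M.rot x ≠ e → σ (dartOfDelete u v x) = dartOfDelete u v (M.rot x) := by
  classical
  let ι := dartOfDelete (G := G) u v
  have hι : Function.Injective ι := dartOfDelete_injective
  set t : G.Dart := ⟨(u, v), huv⟩ with ht
  set t' : G.Dart := ⟨(v, u), huv.symm⟩ with ht'
  have hne : t ≠ t' := fun h => huv.ne (congrArg (fun x : G.Dart => x.fst) h)
  have htr : t ∉ Set.range ι := fun h => mem_range_dartOfDelete.mp h rfl
  have htr' : t' ∉ Set.range ι := fun h => mem_range_dartOfDelete.mp h Sym2.eq_swap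
  have hιt : ∀ x, ι x ≠ t := fun x h => htr ⟨x, h⟩
  have hιt' : ∀ x, ι x ≠ t' := fun x h => htr' ⟨x, h⟩
  have hde : d ≠ e := fun h => huv.ne (hd.symm.trans (h ▸ he))
  have hde' : ι d ≠ ι e := hι.ne hde
  let τ : Equiv.Perm G.Dart := M.rot.extendDomain (Equiv.ofInjective ι hι)
  have hτ : ∀ x, τ (ι x) = ι (M.rot x) := fun x =>
    Equiv.Perm.extendDomain_apply_image M.rot (Equiv.ofInjective ι hι) x
  have hτt : τ t = t := Equiv.Perm.extendDomain_apply_not_subtype M.rot _ htr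
  have hτt' : τ t' = t' := Equiv.Perm.extendDomain_apply_not_subtype M.rot _ htr'
  -- The extension `τ` fixes `t` and `t'`; the swap with `ι d` splices `t` into the cycle just
  -- before `ι d`, and the other swap does the same for `t'` and `ι e`.
  refine ⟨Equiv.swap t (ι d) * Equiv.swap t' (ι e) * τ, ?_, ?_, ?_, ?_, ?_⟩
  · simp only [Equiv.Perm.mul_apply, hτt]
    rw [Equiv.swap_apply_of_ne_of_ne hne (hιt e).symm, Equiv.swap_apply_left]
  · simp only [Equiv.Perm.mul_apply, hτt']
    rw [Equiv.swap_apply_left, Equiv.swap_apply_of_ne_of_ne (hιt e) hde'.symm]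
  · intro x hx
    change Equiv.swap t (ι d) (Equiv.swap t' (ι e) (τ (ι x))) = t
    rw [hτ, hx, Equiv.swap_apply_of_ne_of_ne (hιt' d) hde', Equiv.swap_apply_right]
  · intro x hx
    change Equiv.swap t (ι d) (Equiv.swap t' (ι e) (τ (ι x))) = t'
    rw [hτ, hx, Equiv.swap_apply_right, Equiv.swap_apply_of_ne_of_ne hne.symm (hιt' d).symm]
  · intro x hx hx'
    change Equiv.swap t (ι d) (Equiv.swap t' (ι e) (τ (ι x))) = ι (M.rot x)
    rw [hτ, Equiv.swap_apply_of_ne_of_ne (hιt' _) (hι.ne hx'),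
      Equiv.swap_apply_of_ne_of_ne (hιt _) (hι.ne hx)]

variable [Finite V]

/-- An edge can be drawn inside a face that is incident with both of its ends. -/
theorem IsPlane.isPlanar_of_face_eq {M : (G.deleteEdges {s(u, v)}).RotationSystem}
    (hM : M.IsPlane) (hc : (G.deleteEdges {s(u, v)}).Connected) (huv : G.Adj u v)
    {d e : (G.deleteEdges {s(u, v)}).Dart} (hd : d.fst = u) (he : e.fst = v)
    (hface : M.face d = M.face e) : G.IsPlanar := by
  classical
  have := finite_dart (G := G)
  have := finite_dart (G := G.deleteEdges {s(u, v)})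
  have : Fintype G.Dart := Fintype.ofFinite _
  let ι := dartOfDelete (G := G) u v
  have hι : Function.Injective ι := dartOfDelete_injective
  have hde : d ≠ e := fun h => huv.ne (hd.symm.trans (h ▸ he))
  obtain ⟨σ, hσt, hσt', hσd, hσe, hσ⟩ := exists_insert_rot M huv hd he
  set t : G.Dart := ⟨(u, v), huv⟩ with ht
  set t' : G.Dart := ⟨(v, u), huv.symm⟩ with ht'
  have hne : t ≠ t' := fun h => huv.ne (congrArg (fun x : G.Dart => x.fst) h)
  have htr : ¬ ∃ x, ι x = t := fun h => mem_range_dartOfDelete.mp h rfl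
  have htr' : ¬ ∃ x, ι x = t' := fun h => mem_range_dartOfDelete.mp h Sym2.eq_swap
  have hcases := eq_or_mem_range_dartOfDelete huv
  have hfst : ∀ y, (σ y).fst = y.fst := by
    intro y
    rcases hcases y with rfl | rfl | ⟨x, rfl⟩
    · rw [hσt]; exact hd
    · rw [hσt']; exact he
    · by_cases h1 : M.rot x = d
      · rw [hσd x h1]
        exact hd.symm.trans (h1 ▸ M.rot_fst x)
      · by_cases h2 : M.rot x = e
        · rw [hσe x h2]
          exact he.symm.trans (h2 ▸ M.rot_fst x)
        · rw [hσ x h1 h2]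
          exact M.rot_fst x
  have hstep : ∀ x, σ.SameCycle (ι x) (ι (M.rot x)) := by
    intro x
    by_cases h1 : M.rot x = d
    · refine ⟨2, ?_⟩
      rw [zpow_ofNat, pow_two, Equiv.Perm.mul_apply, hσd x h1, hσt, h1]
    · by_cases h2 : M.rot x = e
      · refine ⟨2, ?_⟩
        rw [zpow_ofNat, pow_two, Equiv.Perm.mul_apply, hσe x h2, hσt', h2]
      · exact ⟨1, by rw [zpow_one, hσ x h1 h2]⟩
  have hold : ∀ x y : (G.deleteEdges {s(u, v)}).Dart, x.fst = y.fst →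
      σ.SameCycle (ι x) (ι y) := fun x y hxy =>
    mem_of_sameCycle (s := {y | σ.SameCycle (ι x) (ι y)})
      (fun z hz => Equiv.Perm.SameCycle.trans hz (hstep z)) (M.sameCycle x y hxy) (.refl _ _)
  have hrep : ∀ y : G.Dart, ∃ x, x.fst = y.fst ∧ σ.SameCycle y (ι x) := by
    intro y
    rcases hcases y with rfl | rfl | ⟨x, rfl⟩
    · exact ⟨d, hd, 1, hσt⟩
    · exact ⟨e, he, 1, hσt'⟩
    · exact ⟨x, rfl, .refl _ _⟩
  let R : RotationSystem G :=
    { rot := σ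
      rot_fst := hfst
      sameCycle := fun y z hyz => by
        obtain ⟨y', hy', hyy'⟩ := hrep y
        obtain ⟨z', hz', hzz'⟩ := hrep z
        exact (hyy'.trans (hold y' z' (hy'.trans (hyz.trans hz'.symm)))).trans hzz'.symm }
  obtain ⟨I, hdI, heI, hIcyc, hId, hIe, hI⟩ := exists_interval (M.face_eq_iff.mp hface) hde
  have hIface : ∀ y ∈ I, M.face y = M.face d := fun y hy => (M.face_eq_iff.mpr (hIcyc y hy)).symm
  -- A colouring of the darts that is constant on the new faces. The new edge cuts the face of `d`
  -- and `e` in two: the arc `I` with `t'` keeps the old colour, and the rest with `t` becomes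
  -- `none`. All colours occur, so there is at least one face more than before.
  let κ₀ : (G.deleteEdges {s(u, v)}).Dart → Option M.Face := fun x =>
    if M.face x = M.face d ∧ x ∉ I then none else some (M.face x)
  let κ : G.Dart → Option M.Face :=
    Function.extend ι κ₀ fun y => if y = t then none else some (M.face d)
  have hκ : ∀ x, κ (ι x) = κ₀ x := fun x => hι.extend_apply _ _ x
  have hκt : κ t = none := by
    rw [show κ t = _ from Function.extend_apply' _ _ _ htr, if_pos rfl]
  have hκt' : κ t' = some (M.face d) := by
    rw [show κ t' = _ from Function.extend_apply' _ _ _ htr', if_neg hne.symm]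
  have hκd : κ (ι d) = some (M.face d) := by rw [hκ]; simp [κ₀, hdI]
  have hκe : κ (ι e) = none := by rw [hκ]; simp [κ₀, heI, hface]
  have hinv : ∀ y, κ (R.facePerm y) = κ y := by
    intro y
    rw [facePerm_apply]
    rcases hcases y with rfl | rfl | ⟨x, rfl⟩
    · change κ (σ t') = κ t
      rw [hσt', hκt]; exact hκe
    · change κ (σ t) = κ t'
      rw [hσt, hκt']; exact hκd
    · change κ (σ (ι x.symm)) = κ (ι x)
      by_cases h1 : M.rot x.symm = d
      · have hx : M.face x = M.face d := by rw [← h1, ← facePerm_apply, face_facePerm]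
        rw [hσd _ h1, hκt, hκ]
        simp [κ₀, hx, hId x h1]
      · by_cases h2 : M.rot x.symm = e
        · have hx : M.face x = M.face d := by rw [hface, ← h2, ← facePerm_apply, face_facePerm]
          rw [hσe _ h2, hκt', hκ]
          simp [κ₀, hx, hIe x h2]
        · rw [hσ _ h1 h2]
          change κ (ι (M.facePerm x)) = _
          rw [hκ, hκ]
          have := hI x h1 h2
          simp only [κ₀, face_facePerm, this]
  have hcard : Nat.card M.Face + 1 ≤ Nat.card R.Face := by
    have := M.finite_face
    have := R.finite_face
    have hlift : ∀ y z, R.facePerm.SameCycle y z → κ y = κ z := fun y z h =>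
      (mem_of_sameCycle (s := {z | κ z = κ y}) (fun x hx => (hinv x).trans hx) h rfl).symm
    let g : R.Face → Option M.Face := Quotient.lift κ hlift
    have hg : Function.Surjective g := by
      intro o
      cases o with
      | none => exact ⟨R.face t, hκt⟩
      | some F =>
        obtain ⟨x, rfl⟩ := M.face_surjective F
        by_cases hx : M.face x = M.face d
        · exact ⟨R.face (ι d), by rw [hx]; exact hκd⟩
        · refine ⟨R.face (ι x), ?_⟩
          change κ (ι x) = _
          rw [hκ]
          simp [κ₀, hx]
    rw [← Finite.card_option]
    exact Nat.card_le_card_of_surjective g hg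
  have hE : G.edgeSet.ncard = (G.deleteEdges {s(u, v)}).edgeSet.ncard + 1 := by
    rw [edgeSet_deleteEdges]
    exact (Set.ncard_sdiff_singleton_add_one ((mem_edgeSet G).mpr huv) (Set.toFinite _)).symm
  have : Nonempty G.Dart := ⟨t⟩
  have : Nonempty (G.deleteEdges {s(u, v)}).Dart := ⟨d⟩
  have hcG : G.Connected := hc.mono (deleteEdges_le _)
  refine ⟨R, (R.isPlane_iff_of_connected hcG).mpr ?_⟩
  have h1 := (M.isPlane_iff_of_connected hc).mp hM
  -- Euler's inequality supplies the upper bound on the number of faces, so the lower bound `hcard`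
  -- suffices.
  have h2 := R.card_add_card_face_le hcG
  omega

end RotationSystem
end SimpleGraph

/-! ### The embedding of `G - {u, v}` induced by that of `G - uv` -/

namespace SimpleGraph
namespace RotationSystem

section Restrict

variable {V W : Type*} [Finite V] {G : SimpleGraph V} {K : SimpleGraph W}

theorem rot_restrict_of_rot_eq (M : RotationSystem G) (f : Copy K G) {d d' : K.Dart}
    (h : M.rot (dartMap f d) = dartMap f d') : (M.restrict f).rot d = d' := by
  change M.next f d = d'
  have h1 := M.returnTime_le f d d' 1 one_pos (by rwa [pow_one])
  have h2 := M.returnTime_pos f d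
  have h3 := M.next_spec f d
  rw [show M.returnTime f d = 1 by omega, pow_one, h] at h3
  exact (dartMap_injective f h3).symm

theorem rot_restrict_of_rot_rot_eq (M : RotationSystem G) (f : Copy K G) {d d' : K.Dart}
    (h0 : M.rot (dartMap f d) ∉ Set.range (dartMap f))
    (h : M.rot (M.rot (dartMap f d)) = dartMap f d') : (M.restrict f).rot d = d' := by
  change M.next f d = d'
  have h1 := M.returnTime_le f d d' 2 two_pos (by rwa [pow_two, Equiv.Perm.mul_apply])
  have h2 := M.returnTime_pos f d
  have h3 := M.next_spec f d
  have h4 : M.returnTime f d ≠ 1 := by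
    intro h4
    rw [h4, pow_one] at h3
    exact h0 ⟨_, h3.symm⟩
  rw [show M.returnTime f d = 2 by omega, pow_two, Equiv.Perm.mul_apply, h] at h3
  exact (dartMap_injective f h3).symm

theorem rot_ne_self (R : RotationSystem G) (h2 : G.IsVertexConnected 2) (d : G.Dart) :
    R.rot d ≠ d := by
  have := finite_dart (G := G)
  intro h
  obtain ⟨z, hz, hadj⟩ := h2.exists_adj_ne d.fst d.snd
  have : (⟨(d.fst, z), hadj⟩ : G.Dart) ∈ ({d} : Set G.Dart) :=
    mem_of_sameCycle (by rintro _ rfl; exact h) (R.sameCycle d ⟨(d.fst, z), hadj⟩ rfl) rfl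
  exact hz (congrArg (fun c : G.Dart => c.snd) this)

end Restrict

section DeleteEnds

variable {V : Type*} {G : SimpleGraph V} {u v : V}

/-- A dart of `G - {u, v}` as a dart of `G - uv`. -/
abbrev endsDart (G : SimpleGraph V) (u v : V) (d : (G.induce {u, v}ᶜ).Dart) :
    (G.deleteEdges {s(u, v)}).Dart := dartMap (G.deleteEndsCopy u v) d

theorem endsDart_injective : Function.Injective (endsDart G u v) :=
  dartMap_injective _

theorem mem_range_endsDart {y : (G.deleteEdges {s(u, v)}).Dart} :
    y ∈ Set.range (endsDart G u v) ↔ y.fst ∉ ({u, v} : Set V) ∧ y.snd ∉ ({u, v} : Set V) := by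
  constructor
  · rintro ⟨x, rfl⟩
    exact ⟨x.fst.2, x.snd.2⟩
  · rintro ⟨h1, h2⟩
    exact ⟨⟨(⟨y.fst, h1⟩, ⟨y.snd, h2⟩), (deleteEdges_adj.mp y.adj).1⟩, rfl⟩

theorem snd_notMem_of_fst_mem {y : (G.deleteEdges {s(u, v)}).Dart}
    (h : y.fst ∈ ({u, v} : Set V)) : y.snd ∉ ({u, v} : Set V) := by
  intro h'
  obtain ⟨-, h2⟩ := deleteEdges_adj.mp y.adj
  have hne := y.adj.ne
  rcases h with h | h <;> rcases h' with h' | h'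
  · exact hne (h.trans h'.symm)
  · exact h2 (by rw [h, Set.mem_singleton_iff.mp h']; rfl)
  · exact h2 (by rw [Set.mem_singleton_iff.mp h, h', Sym2.eq_swap]; rfl)
  · exact hne (h.trans h'.symm)

/-- A plane embedding of the 2-connected graph `G - uv` in which `u` and `v` have no common neighbour
and no common face. -/
structure EndsApart (M : (G.deleteEdges {s(u, v)}).RotationSystem) : Prop where
  isPlane : M.IsPlane
  isVertexConnected : (G.deleteEdges {s(u, v)}).IsVertexConnected 2
  eq_of_adj : ∀ x y z, (G.deleteEdges {s(u, v)}).Adj x y → (G.deleteEdges {s(u, v)}).Adj x z →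
    y ∈ ({u, v} : Set V) → z ∈ ({u, v} : Set V) → y = z
  fst_eq_of_face_eq : ∀ δ ε : (G.deleteEdges {s(u, v)}).Dart, δ.fst ∈ ({u, v} : Set V) →
    ε.fst ∈ ({u, v} : Set V) → M.face δ = M.face ε → δ.fst = ε.fst

namespace EndsApart

variable [Finite V] {M : (G.deleteEdges {s(u, v)}).RotationSystem}

/-- After leaving a removed vertex, a face cannot run into a removed vertex at once: it would have
to be the same one, by `eq_of_adj`, and then the rotation would fix a dart. So face tracing never
skips two removed edges in a row without a kept dart in between. -/
theorem exists_endsDart_eq_facePerm (h : M.EndsApart)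
    {δ : (G.deleteEdges {s(u, v)}).Dart} (hδ : δ.fst ∈ ({u, v} : Set V)) :
    ∃ c, endsDart G u v c = M.facePerm δ := by
  rw [← Set.mem_range, mem_range_endsDart]
  have hfst := M.facePerm_fst δ
  refine ⟨by rw [hfst]; exact snd_notMem_of_fst_mem hδ, fun hs => ?_⟩
  have heq := h.eq_of_adj δ.snd _ _ (hfst ▸ (M.facePerm δ).adj) δ.adj.symm hs hδ
  exact M.rot_ne_self h.isVertexConnected δ.symm (Dart.ext _ _ (Prod.ext hfst heq))

/-- Face tracing in `G - {u, v}` is face tracing in `G - uv`, except that the removed edges at `u`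
and `v` are skipped. -/
theorem endsDart_facePerm_restrict (h : M.EndsApart) (d : (G.induce {u, v}ᶜ).Dart) :
    endsDart G u v ((M.restrict (G.deleteEndsCopy u v)).facePerm d) =
        M.facePerm (endsDart G u v d) ∨
      ∃ δ : (G.deleteEdges {s(u, v)}).Dart, δ.fst ∈ ({u, v} : Set V) ∧
        M.facePerm (endsDart G u v d) = δ.symm ∧
        endsDart G u v ((M.restrict (G.deleteEndsCopy u v)).facePerm d) = M.facePerm δ := by
  by_cases hr : M.facePerm (endsDart G u v d) ∈ Set.range (endsDart G u v)
  · obtain ⟨d', hd'⟩ := hr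
    left
    rw [facePerm_apply, rot_restrict_of_rot_eq M _ (d := d.symm) (d' := d') hd'.symm, hd']
  · right
    have hfst : (M.facePerm (endsDart G u v d)).fst ∉ ({u, v} : Set V) := by
      rw [facePerm_fst]; exact d.snd.2
    have hsnd : (M.facePerm (endsDart G u v d)).snd ∈ ({u, v} : Set V) := by
      by_contra hs
      exact hr (mem_range_endsDart.mpr ⟨hfst, hs⟩)
    obtain ⟨d', hd'⟩ := h.exists_endsDart_eq_facePerm
      (δ := (M.facePerm (endsDart G u v d)).symm) hsnd
    refine ⟨(M.facePerm (endsDart G u v d)).symm, hsnd, (Dart.symm_symm _).symm, ?_⟩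
    rw [← hd', facePerm_apply, rot_restrict_of_rot_rot_eq M _ (d := d.symm) (d' := d') hr]
    rw [facePerm_apply, Dart.symm_symm] at hd'
    exact hd'.symm

theorem face_endsDart_eq_of_no_end (h : M.EndsApart) {d d' : (G.induce {u, v}ᶜ).Dart}
    (hno : ∀ δ : (G.deleteEdges {s(u, v)}).Dart, δ.fst ∈ ({u, v} : Set V) →
      M.face δ ≠ M.face (endsDart G u v d))
    (hdd' : (M.restrict (G.deleteEndsCopy u v)).face d =
      (M.restrict (G.deleteEndsCopy u v)).face d') :
    M.face (endsDart G u v d') = M.face (endsDart G u v d) := by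
  have := finite_dart (G := G.induce {u, v}ᶜ)
  refine mem_of_sameCycle (s := {x | M.face (endsDart G u v x) = M.face (endsDart G u v d)})
    (fun x hx => ?_) (face_eq_iff _ |>.mp hdd') rfl
  rcases h.endsDart_facePerm_restrict x with h' | ⟨δ, hδ, hδx, -⟩
  · change M.face _ = _
    rw [h', face_facePerm]; exact hx
  · refine absurd ?_ (hno (M.rot δ) (by rwa [M.rot_fst]))
    rw [face_rot, ← hδx, face_facePerm]; exact hx

/-- Touching `w` is an invariant of face tracing in `G - {u, v}`: when the tracing skips a removed
vertex, the old face on which it arrives contains that vertex. If that face touches `w`, the vertex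
is `w`, and the face on which the tracing continues touches `w` too. -/
theorem exists_end_of_face_eq (h : M.EndsApart) {w : V} (hw : w ∈ ({u, v} : Set V))
    {d d' : (G.induce {u, v}ᶜ).Dart}
    (hdd' : (M.restrict (G.deleteEndsCopy u v)).face d =
      (M.restrict (G.deleteEndsCopy u v)).face d')
    (hd : ∃ δ : (G.deleteEdges {s(u, v)}).Dart, δ.fst = w ∧
      M.face δ = M.face (endsDart G u v d)) :
    ∃ δ : (G.deleteEdges {s(u, v)}).Dart, δ.fst = w ∧
      M.face δ = M.face (endsDart G u v d') := by
  have := finite_dart (G := G.induce {u, v}ᶜ)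
  refine mem_of_sameCycle (s := {x | ∃ δ : (G.deleteEdges {s(u, v)}).Dart, δ.fst = w ∧
    M.face δ = M.face (endsDart G u v x)}) (fun x hx => ?_) (face_eq_iff _ |>.mp hdd') hd
  obtain ⟨ε, hε, hεx⟩ := hx
  rcases h.endsDart_facePerm_restrict x with h' | ⟨δ, hδ, hδx, hδN⟩
  · refine ⟨ε, hε, ?_⟩
    rw [h', face_facePerm]; exact hεx
  · refine ⟨δ, ?_, by rw [hδN, face_facePerm]⟩
    have hface : M.face (M.rot δ) = M.face ε := by
      rw [face_rot, ← hδx, face_facePerm]; exact hεx.symm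
    rw [← hε, ← h.fst_eq_of_face_eq (M.rot δ) ε (by rwa [M.rot_fst]) (by rwa [hε]) hface, M.rot_fst]

/-- The old face between two consecutive edges at a removed vertex leaves along the second and
returns along the first. The new tracing follows it from `c'` until it meets that first edge, skips
it, and goes on with `c`. -/
theorem face_eq_of_endsDart_eq_facePerm_rot (h : M.EndsApart)
    {δ : (G.deleteEdges {s(u, v)}).Dart} (hδ : δ.fst ∈ ({u, v} : Set V))
    {c c' : (G.induce {u, v}ᶜ).Dart} (hc : endsDart G u v c = M.facePerm δ)
    (hc' : endsDart G u v c' = M.facePerm (M.rot δ)) :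
    (M.restrict (G.deleteEndsCopy u v)).face c' =
      (M.restrict (G.deleteEndsCopy u v)).face c := by
  classical
  have := finite_dart (G := G.deleteEdges {s(u, v)})
  set N := M.restrict (G.deleteEndsCopy u v) with hN
  have hex : ∃ k, (M.facePerm ^ k) (endsDart G u v c') ∉ Set.range (endsDart G u v) := by
    have hs : M.facePerm.SameCycle (M.facePerm (M.rot δ)) (M.rot δ) :=
      M.face_eq_iff.mp (M.face_facePerm _)
    obtain ⟨k, hk⟩ := hs.exists_nat_pow_eq
    refine ⟨k, fun hr => ?_⟩
    rw [hc', hk] at hr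
    exact (mem_range_endsDart.mp hr).1 (by rwa [M.rot_fst])
  obtain ⟨k, hk⟩ : ∃ k, Nat.find hex = k + 1 :=
    Nat.exists_eq_succ_of_ne_zero fun h0 => by
      have := Nat.find_spec hex
      rw [h0] at this
      exact this ⟨c', rfl⟩
  have hout := Nat.find_spec hex
  rw [hk] at hout
  have hin : ∀ j ≤ k, (M.facePerm ^ j) (endsDart G u v c') ∈ Set.range (endsDart G u v) :=
    fun j hj => not_not.mp (Nat.find_min hex (by omega))
  have htrace : ∀ j ≤ k, endsDart G u v ((N.facePerm ^ j) c') =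
      (M.facePerm ^ j) (endsDart G u v c') := by
    intro j
    induction j with
    | zero => intro _; rfl
    | succ j ih =>
      intro hj
      rw [pow_succ', Equiv.Perm.mul_apply, pow_succ', Equiv.Perm.mul_apply, ← ih (by omega)]
      rcases h.endsDart_facePerm_restrict ((N.facePerm ^ j) c') with
        h' | ⟨ε, hε, hεx, -⟩
      · exact h'
      · have := hin (j + 1) hj
        rw [pow_succ', Equiv.Perm.mul_apply, ← ih (by omega), hεx, mem_range_endsDart] at this
        exact absurd hε this.2
  rw [pow_succ', Equiv.Perm.mul_apply, ← htrace k le_rfl] at hout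
  rcases h.endsDart_facePerm_restrict ((N.facePerm ^ k) c') with
    h' | ⟨ε, hε, hεx, hεN⟩
  · exact absurd ⟨_, h'⟩ hout
  · have hface : M.face (M.rot ε) = M.face (M.rot δ) := by
      rw [face_rot, ← hεx, face_facePerm, htrace k le_rfl, ← M.face_facePerm (M.rot δ), ← hc']
      exact M.face_eq_iff.mpr (Equiv.Perm.SameCycle.symm ⟨k, rfl⟩)
    have hfst := h.fst_eq_of_face_eq _ _ (by rwa [M.rot_fst]) (by rwa [M.rot_fst]) hface
    have hεδ : ε = δ := M.rot.injective (h.isPlane.dart_eq_of_face_eq h.isVertexConnected hfst hface)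
    rw [hεδ, ← hc] at hεN
    rw [← endsDart_injective hεN]
    refine N.face_eq_iff.mpr ⟨(k + 1 : ℕ), ?_⟩
    rw [zpow_natCast, pow_succ', Equiv.Perm.mul_apply]

/-- All neighbours of a removed vertex lie on a common face. -/
theorem exists_endFace (h : M.EndsApart) {w : V} (hw : w ∈ ({u, v} : Set V)) :
    ∃ F : (M.restrict (G.deleteEndsCopy u v)).Face,
      ∀ (δ : (G.deleteEdges {s(u, v)}).Dart) (c : (G.induce {u, v}ᶜ).Dart), δ.fst = w →
        endsDart G u v c = M.facePerm δ → (M.restrict (G.deleteEndsCopy u v)).face c = F := by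
  have := finite_dart (G := G.deleteEdges {s(u, v)})
  obtain ⟨y, -, hy⟩ := h.isVertexConnected.exists_adj_ne w w
  let δ₀ : (G.deleteEdges {s(u, v)}).Dart := ⟨(w, y), hy⟩
  obtain ⟨c₀, hc₀⟩ := h.exists_endsDart_eq_facePerm (δ := δ₀) hw
  refine ⟨(M.restrict (G.deleteEndsCopy u v)).face c₀, fun δ c hδ => ?_⟩
  have key : δ ∈ {δ | δ.fst = w ∧ ∀ c, endsDart G u v c = M.facePerm δ →
      (M.restrict (G.deleteEndsCopy u v)).face c =
        (M.restrict (G.deleteEndsCopy u v)).face c₀} := by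
    refine mem_of_sameCycle ?_ (M.sameCycle δ₀ δ hδ.symm) ?_
    · rintro δ ⟨hδ, ih⟩
      refine ⟨by rwa [M.rot_fst], fun c' hc' => ?_⟩
      obtain ⟨c, hc⟩ := h.exists_endsDart_eq_facePerm (δ := δ) (by rwa [hδ])
      rw [← ih c hc]
      exact h.face_eq_of_endsDart_eq_facePerm_rot (by rwa [hδ]) hc hc'
    · refine ⟨rfl, fun c hc => ?_⟩
      rw [endsDart_injective (hc.trans hc₀.symm)]
  exact key.2 c

/-- If the faces agreed, `exists_end_of_face_eq` would carry `u` to an old face at `v`. -/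
theorem endFace_ne (h : M.EndsApart) {δ ε : (G.deleteEdges {s(u, v)}).Dart} (hδ : δ.fst = u)
    (hε : ε.fst = v) (huv : u ≠ v) {c c' : (G.induce {u, v}ᶜ).Dart}
    (hc : endsDart G u v c = M.facePerm δ) (hc' : endsDart G u v c' = M.facePerm ε) :
    (M.restrict (G.deleteEndsCopy u v)).face c ≠
      (M.restrict (G.deleteEndsCopy u v)).face c' := by
  intro hface
  obtain ⟨δ', hδ', hδ'c⟩ := h.exists_end_of_face_eq (Or.inl rfl) hface
    ⟨δ, hδ, by rw [hc, face_facePerm]⟩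
  rw [hc', face_facePerm] at hδ'c
  exact huv (hδ'.symm.trans
    ((h.fst_eq_of_face_eq _ _ (Or.inl hδ') (Or.inr hε) hδ'c).trans hε))

/-- Deleting the two vertices destroys at most four faces. -/
theorem card_face_le (h : M.EndsApart) (huv : u ≠ v)
    (hdeg : ∀ x ∈ ({u, v} : Set V), ((G.deleteEdges {s(u, v)}).neighborSet x).ncard = 3) :
    Nat.card M.Face ≤ Nat.card (M.restrict (G.deleteEndsCopy u v)).Face + 4 := by
  classical
  have := finite_dart (G := G.deleteEdges {s(u, v)})
  set N := M.restrict (G.deleteEndsCopy u v) with hN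
  have := M.finite_face
  have := N.finite_face
  obtain ⟨Fu, hFu⟩ := h.exists_endFace (w := u) (Or.inl rfl)
  obtain ⟨Fv, hFv⟩ := h.exists_endFace (w := v) (Or.inr rfl)
  have hw : ∀ w, w ∈ ({u, v} : Set V) → ∃ (δ : (G.deleteEdges {s(u, v)}).Dart) (c : _),
      δ.fst = w ∧ endsDart G u v c = M.facePerm δ := by
    intro w hw
    obtain ⟨y, -, hy⟩ := h.isVertexConnected.exists_adj_ne w w
    obtain ⟨c, hc⟩ := h.exists_endsDart_eq_facePerm (δ := ⟨(w, y), hy⟩) hw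
    exact ⟨_, c, rfl, hc⟩
  obtain ⟨δ, c, hδ, hc⟩ := hw u (Or.inl rfl)
  obtain ⟨ε, c', hε, hc'⟩ := hw v (Or.inr rfl)
  have hne : Fu ≠ Fv := by
    rw [← hFu δ c hδ hc, ← hFv ε c' hε hc']
    exact h.endFace_ne hδ hε huv hc hc'
  -- An old face that avoids `u` and `v` survives as a new face other than `Fu` and `Fv`; every
  -- other old face is named by one of the six removed edges. This bounds the old number by the new
  -- one minus `2` plus `6`.
  let T := ({Fu, Fv}ᶜ : Set N.Face) ⊕ ((G.deleteEdges {s(u, v)}).neighborSet u ⊕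
    (G.deleteEdges {s(u, v)}).neighborSet v)
  let g : T → M.Face := Sum.elim
    (fun F => M.face (endsDart G u v (N.face_surjective F.1).choose))
    (Sum.elim (fun y => M.face ⟨(u, y.1), y.2⟩) (fun y => M.face ⟨(v, y.1), y.2⟩))
  have hg : Function.Surjective g := by
    intro Y
    obtain ⟨y, rfl⟩ := M.face_surjective Y
    by_cases hY : ∃ δ : (G.deleteEdges {s(u, v)}).Dart, δ.fst ∈ ({u, v} : Set V) ∧
        M.face δ = M.face y
    · obtain ⟨⟨⟨x, x'⟩, hx⟩, hxe, hδy⟩ := hY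
      obtain hxe | hxe : x = u ∨ x = v := hxe <;> subst x
      · exact ⟨Sum.inr (Sum.inl ⟨x', hx⟩), hδy⟩
      · exact ⟨Sum.inr (Sum.inr ⟨x', hx⟩), hδy⟩
    · push Not at hY
      obtain ⟨d, rfl⟩ : y ∈ Set.range (endsDart G u v) := by
        refine mem_range_endsDart.mpr ⟨fun hy => hY y hy rfl, fun hy => ?_⟩
        exact hY (M.facePerm y) (by rwa [facePerm_fst]) (M.face_facePerm y)
      have hd : ∀ w ∈ ({u, v} : Set V), ∀ (δ : (G.deleteEdges {s(u, v)}).Dart) (c : _),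
          δ.fst = w → endsDart G u v c = M.facePerm δ → N.face d ≠ N.face c := by
        intro w hw δ c hδ hc hface
        obtain ⟨δ', hδ', hδ'd⟩ := h.exists_end_of_face_eq hw hface.symm
          ⟨δ, hδ, by rw [hc, face_facePerm]⟩
        exact hY δ' (by rwa [hδ']) hδ'd
      have hmem : N.face d ∈ ({Fu, Fv}ᶜ : Set N.Face) := by
        rintro (hF | hF)
        · exact hd u (Or.inl rfl) δ c hδ hc (hF.trans (hFu δ c hδ hc).symm)
        · exact hd v (Or.inr rfl) ε c' hε hc' (hF.trans (hFv ε c' hε hc').symm)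
      refine ⟨Sum.inl ⟨N.face d, hmem⟩, ?_⟩
      exact h.face_endsDart_eq_of_no_end hY (N.face_surjective (N.face d)).choose_spec.symm
  have hcard := Nat.card_le_card_of_surjective g hg
  have hT : Nat.card T = Nat.card ({Fu, Fv}ᶜ : Set N.Face) + (3 + 3) := by
    rw [Nat.card_sum, Nat.card_sum, Nat.card_coe_set_eq ((G.deleteEdges {s(u, v)}).neighborSet u),
      Nat.card_coe_set_eq ((G.deleteEdges {s(u, v)}).neighborSet v), hdeg u (Or.inl rfl),
      hdeg v (Or.inr rfl)]
  have hcompl := Set.ncard_add_ncard_compl ({Fu, Fv} : Set N.Face)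
  rw [Set.ncard_pair hne, ← Nat.card_coe_set_eq ({Fu, Fv}ᶜ : Set N.Face)] at hcompl
  omega

/-- The embedding of `G - {u, v}` that is induced by a plane embedding of `G - uv` is plane. -/
theorem isPlane_restrict (h : M.EndsApart) (huv : u ≠ v)
    (hdeg : ∀ x ∈ ({u, v} : Set V), ((G.deleteEdges {s(u, v)}).neighborSet x).ncard = 3)
    (hK : (G.induce {u, v}ᶜ).IsVertexConnected 2) :
    (M.restrict (G.deleteEndsCopy u v)).IsPlane := by
  classical
  have := h.isVertexConnected.nonempty_dart
  have := hK.nonempty_dart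
  have := finite_dart (G := G.induce {u, v}ᶜ)
  have : Fintype (G.induce {u, v}ᶜ).Dart := Fintype.ofFinite _
  rw [isPlane_iff_of_connected _ (hK.connected two_pos)]
  have h1 := (isPlane_iff_of_connected M (h.isVertexConnected.connected two_pos)).mp h.isPlane
  have h2 := h.card_face_le huv hdeg
  have h3 := (M.restrict (G.deleteEndsCopy u v)).card_add_card_face_le (hK.connected two_pos)
  have h4 := Set.ncard_add_ncard_compl ({u, v} : Set V)
  rw [Set.ncard_pair huv, ← Nat.card_coe_set_eq ({u, v}ᶜ : Set V)] at h4
  -- Two vertices, at least six edges and at most four faces are lost. The Euler expression `|V| -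
  -- |E| + |F|` does not drop below `2`, and `h3` bounds it from above.
  have h5 : (G.induce {u, v}ᶜ).edgeSet.ncard + 6 ≤
      (G.deleteEdges {s(u, v)}).edgeSet.ncard := by
    let T := (G.induce {u, v}ᶜ).edgeSet ⊕ ((G.deleteEdges {s(u, v)}).neighborSet u ⊕
      (G.deleteEdges {s(u, v)}).neighborSet v)
    let g : T → Sym2 V := Sum.elim (fun e => e.1.map Subtype.val)
      (Sum.elim (fun y => s(u, y.1)) (fun y => s(v, y.1)))
    have hgmem : ∀ t, g t ∈ (G.deleteEdges {s(u, v)}).edgeSet := by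
      rintro (⟨e, he⟩ | y | y)
      · induction e with
        | _ x y => exact (G.deleteEndsCopy u v).toHom.map_adj he
      · exact y.2
      · exact y.2
    have hend : ∀ (e : Sym2 ↥({u, v}ᶜ : Set V)) (w y : V), w ∈ ({u, v} : Set V) →
        e.map Subtype.val ≠ s(w, y) := by
      intro e w y hw he
      have : w ∈ e.map Subtype.val := he ▸ Sym2.mem_mk_left w y
      obtain ⟨x, -, rfl⟩ := Sym2.mem_map.mp this
      exact x.2 hw
    have hside : ∀ (y : (G.deleteEdges {s(u, v)}).neighborSet u)
        (y' : (G.deleteEdges {s(u, v)}).neighborSet v), s(u, y.1) ≠ s(v, y'.1) := by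
      intro y y' he
      rcases Sym2.eq_iff.mp he with ⟨h1, -⟩ | ⟨-, h1⟩
      · exact huv h1
      · exact snd_notMem_of_fst_mem (y := ⟨(u, y.1), y.2⟩) (Or.inl rfl) (Or.inr h1)
    have hg : Function.Injective g := by
      rintro (⟨e, he⟩ | y | y) (⟨e', he'⟩ | y' | y') heq
      · exact congrArg Sum.inl (Subtype.ext (Sym2.map.injective Subtype.val_injective heq))
      · exact absurd heq (hend _ _ _ (Or.inl rfl))
      · exact absurd heq (hend _ _ _ (Or.inr rfl))
      · exact absurd heq.symm (hend _ _ _ (Or.inl rfl))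
      · exact congrArg (Sum.inr ∘ Sum.inl) (Subtype.ext (Sym2.congr_right.mp heq))
      · exact absurd heq (hside y y')
      · exact absurd heq.symm (hend _ _ _ (Or.inr rfl))
      · exact absurd heq.symm (hside y' y)
      · exact congrArg (Sum.inr ∘ Sum.inr) (Subtype.ext (Sym2.congr_right.mp heq))
    have hcard := Nat.card_le_card_of_injective
      (fun t => (⟨g t, hgmem t⟩ : (G.deleteEdges {s(u, v)}).edgeSet))
      (fun t t' htt' => hg (congrArg Subtype.val htt'))
    have hT : Nat.card T = (G.induce {u, v}ᶜ).edgeSet.ncard + (3 + 3) := by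
      rw [Nat.card_sum, Nat.card_sum,
        Nat.card_coe_set_eq ((G.deleteEdges {s(u, v)}).neighborSet u),
        Nat.card_coe_set_eq ((G.deleteEdges {s(u, v)}).neighborSet v), hdeg u (Or.inl rfl),
        hdeg v (Or.inr rfl), Nat.card_coe_set_eq]
    rw [hT, Nat.card_coe_set_eq] at hcard
    omega
  omega

end EndsApart

end DeleteEnds

end RotationSystem
end SimpleGraph

/-! ### Vertices of degree two in internally 3-connected graphs -/

namespace SimpleGraph

variable {V : Type*} {G : SimpleGraph V}

/-- The vertices at which the edges in `A` meet the other edges. -/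
def edgeBoundary (G : SimpleGraph V) (A : Set (Sym2 V)) : Set V :=
  {x | (∃ y, G.Adj x y ∧ s(x, y) ∈ A) ∧ ∃ y, G.Adj x y ∧ s(x, y) ∉ A}

theorem edgeBoundary_compl (A : Set (Sym2 V)) : G.edgeBoundary Aᶜ = G.edgeBoundary A := by
  ext x
  simp only [edgeBoundary, Set.mem_ofPred_eq, Set.mem_compl_iff, not_not]
  exact and_comm

/-- The subgraph formed by a set of edges and their ends. -/
def edgeSubgraph (G : SimpleGraph V) (A : Set (Sym2 V)) : G.Subgraph where
  verts := {x | ∃ y, G.Adj x y ∧ s(x, y) ∈ A}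
  Adj x y := G.Adj x y ∧ s(x, y) ∈ A
  adj_sub h := h.1
  edge_vert {x y} h := ⟨y, h⟩
  symm := ⟨fun x y h => ⟨h.1.symm, by rw [Sym2.eq_swap]; exact h.2⟩⟩

theorem edgeSubgraph_edgeSet (A : Set (Sym2 V)) :
    (G.edgeSubgraph A).edgeSet = G.edgeSet ∩ A := by
  ext e
  induction e with
  | _ x y => rfl

/-- A set of edges and its complement span two edge-disjoint subgraphs that meet exactly in the
boundary, so separations can be handled as edge sets. -/
theorem IsInternallyThreeConnected.ncard_le_two [Finite V] (hG : G.IsInternallyThreeConnected)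
    (A : Set (Sym2 V)) (hA : (G.edgeBoundary A).ncard = 2) :
    (G.edgeSet ∩ A).ncard ≤ 2 ∨ (G.edgeSet ∩ Aᶜ).ncard ≤ 2 := by
  have h := hG.2 (G.edgeSubgraph A) (G.edgeSubgraph Aᶜ) ⟨?_, ?_, hA⟩
  · rwa [edgeSubgraph_edgeSet, edgeSubgraph_edgeSet] at h
  · refine Subgraph.ext ?_ ?_
    · refine Set.eq_univ_of_forall fun x => ?_
      obtain ⟨y, -, hy⟩ := hG.1.exists_adj_ne x x
      by_cases hxy : s(x, y) ∈ A
      · exact Or.inl ⟨y, hy, hxy⟩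
      · exact Or.inr ⟨y, hy, hxy⟩
    · ext x y
      change (G.Adj x y ∧ s(x, y) ∈ A) ∨ (G.Adj x y ∧ s(x, y) ∉ A) ↔ G.Adj x y
      tauto
  · rw [edgeSubgraph_edgeSet, edgeSubgraph_edgeSet]
    exact disjoint_compl_right.mono Set.inter_subset_right Set.inter_subset_right

theorem IsVertexConnected.card_le_ncard_edgeSet [Finite V] (h : G.IsVertexConnected 2) :
    Nat.card V ≤ G.edgeSet.ncard := by
  classical
  have : Fintype V := Fintype.ofFinite V
  have hdeg : ∀ x, 2 ≤ G.degree x := by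
    intro x
    obtain ⟨y, -, hy⟩ := h.exists_adj_ne x x
    obtain ⟨z, hzy, hz⟩ := h.exists_adj_ne x y
    rw [← G.card_neighborFinset_eq_degree, ← Finset.card_pair hzy]
    refine Finset.card_le_card fun w hw => ?_
    rw [mem_neighborFinset]
    rcases Finset.mem_insert.mp hw with rfl | hw
    · exact hz
    · rwa [Finset.mem_singleton.mp hw]
  have h1 := G.sum_degrees_eq_twice_card_edges
  have h2 : ∑ _x : V, 2 ≤ ∑ x, G.degree x := Finset.sum_le_sum fun x _ => hdeg x
  rw [h1, Finset.sum_const, Finset.card_univ, smul_eq_mul, ← Nat.card_eq_fintype_card] at h2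
  rw [← coe_edgeFinset, Set.ncard_coe_finset]
  omega

theorem eq_of_ncard_neighborSet_eq_two {x a b c : V} (hx : (G.neighborSet x).ncard = 2)
    (ha : G.Adj x a) (hb : G.Adj x b) (hc : G.Adj x c) (hab : a ≠ b) (hac : c ≠ a) : c = b := by
  obtain ⟨s, t, -, hst⟩ := Set.ncard_eq_two.mp hx
  have h : ∀ y, G.Adj x y → y = s ∨ y = t := fun y hy => by
    have : y ∈ G.neighborSet x := hy
    rwa [hst] at this
  grind

/-- In an internally 3-connected graph with at least six vertices, no two vertices of degree two are
adjacent. -/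
theorem IsInternallyThreeConnected.not_adj_of_degree_two [Finite V]
    (hG : G.IsInternallyThreeConnected) (hV : 6 ≤ Nat.card V) {p q : V}
    (hp : (G.neighborSet p).ncard = 2) (hq : (G.neighborSet q).ncard = 2) : ¬ G.Adj p q := by
  intro hpq
  obtain ⟨x, hxq, hpx⟩ := hG.1.exists_adj_ne p q
  obtain ⟨y, hyp, hqy⟩ := hG.1.exists_adj_ne q p
  have hpn : ∀ z, G.Adj p z → z = q ∨ z = x := fun z hz => by
    by_cases h : z = q
    · exact Or.inl h
    · exact Or.inr (eq_of_ncard_neighborSet_eq_two hp hpq hpx hz hxq.symm h)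
  have hqn : ∀ z, G.Adj q z → z = p ∨ z = y := fun z hz => by
    by_cases h : z = p
    · exact Or.inl h
    · exact Or.inr (eq_of_ncard_neighborSet_eq_two hq hpq.symm hqy hz hyp.symm h)
  have hcard : ∀ s : Finset V, s.card ≤ 3 → ∃ z, z ∉ s := by
    intro s hs
    by_contra! hall
    have : Set.ncard (Set.univ : Set V) ≤ (s : Set V).ncard :=
      Set.ncard_le_ncard fun z _ => hall z
    rw [Set.ncard_univ, Set.ncard_coe_finset] at this
    omega
  classical
  -- If the outer neighbours of `p` and `q` coincide, they form a cut vertex. Otherwise the three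
  -- edges at `p` and `q` are cut off by `x` and `y`, and at least three edges remain as `|E| ≥ |V|
  -- ≥ 6`.
  by_cases hxy : x = y
  · subst hxy
    obtain ⟨z, hz⟩ := hcard {p, q, x} Finset.card_le_three
    simp only [Finset.mem_insert, Finset.mem_singleton, not_or] at hz
    have := hG.1.forall_of_adj_of_ne (x := x) (P := fun w => w = p ∨ w = q) (y := p) hpx.ne
      (Or.inl rfl) (by
        rintro a b ha hb hab (rfl | rfl)
        · rcases hpn b hab with h | h
          · exact Or.inr h
          · exact absurd h hb
        · rcases hqn b hab with h | h
          · exact Or.inl h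
          · exact absurd h hb) hz.2.2
    tauto
  · let A : Set (Sym2 V) := {e | p ∈ e ∨ q ∈ e}
    have hmemA : ∀ a b : V, s(a, b) ∈ A ↔ (p = a ∨ p = b) ∨ (q = a ∨ q = b) := fun a b => by
      change (p ∈ s(a, b) ∨ q ∈ s(a, b)) ↔ _
      rw [Sym2.mem_iff, Sym2.mem_iff]
    have hbd : G.edgeBoundary A = {x, y} := by
      ext w
      constructor
      · rintro ⟨⟨a, hwa, haA⟩, b, hwb, hbA⟩
        rw [hmemA] at haA hbA
        push Not at hbA
        rcases haA with (h | h) | (h | h)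
        · exact absurd h hbA.1.1
        · subst h
          rcases hpn w hwa.symm with h | h
          · exact absurd h.symm hbA.2.1
          · exact Or.inl h
        · exact absurd h hbA.2.1
        · subst h
          rcases hqn w hwa.symm with h | h
          · exact absurd h.symm hbA.1.1
          · exact Or.inr h
      · rintro (rfl | rfl)
        · refine ⟨⟨p, hpx.symm, (hmemA _ _).mpr (Or.inl (Or.inr rfl))⟩, ?_⟩
          obtain ⟨z, hz, hwz⟩ := hG.1.exists_adj_ne w p
          refine ⟨z, hwz, fun h => ?_⟩
          rcases (hmemA _ _).mp h with (h | h) | (h | h)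
          · exact hpx.ne h
          · exact hz h.symm
          · exact hxq h.symm
          · subst h
            rcases hqn w hwz.symm with h | h
            · exact hpx.ne h.symm
            · exact hxy h
        · refine ⟨⟨q, hqy.symm, (hmemA _ _).mpr (Or.inr (Or.inr rfl))⟩, ?_⟩
          obtain ⟨z, hz, hwz⟩ := hG.1.exists_adj_ne w q
          refine ⟨z, hwz, fun h => ?_⟩
          rcases (hmemA _ _).mp h with (h | h) | (h | h)
          · exact hyp h.symm
          · subst h
            rcases hpn w hwz.symm with h | h
            · exact hqy.ne h.symm
            · exact hxy h.symm
          · exact hqy.ne h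
          · exact hz h.symm
    have hA : G.edgeSet ∩ A = {s(p, q), s(p, x), s(q, y)} := by
      ext e
      induction e with
      | _ a b =>
        constructor
        · rintro ⟨hab, h⟩
          change G.Adj a b at hab
          rcases (hmemA _ _).mp h with (rfl | rfl) | (rfl | rfl)
          · rcases hpn _ hab with rfl | rfl <;> simp
          · rcases hpn _ hab.symm with rfl | rfl <;> simp
          · rcases hqn _ hab with rfl | rfl <;> simp
          · rcases hqn _ hab.symm with rfl | rfl <;> simp
        · rintro (h | h | h)
          · rw [h]; exact ⟨hpq, Or.inl (Sym2.mem_mk_left _ _)⟩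
          · rw [h]; exact ⟨hpx, Or.inl (Sym2.mem_mk_left _ _)⟩
          · rw [Set.mem_singleton_iff.mp h]; exact ⟨hqy, Or.inr (Sym2.mem_mk_left _ _)⟩
    have hA3 : (G.edgeSet ∩ A).ncard = 3 := by
      rw [hA, Set.ncard_eq_three]
      have hne := hpq.ne
      refine ⟨_, _, _, ?_, ?_, ?_, rfl⟩
      · simp [hxq.symm, hne.symm]
      · simp [hne, hyp.symm]
      · simp [hne, hyp.symm]
    have hsum := Set.ncard_inter_add_ncard_sdiff_eq_ncard G.edgeSet A (Set.toFinite _)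
    have hE := hG.1.card_le_ncard_edgeSet
    rw [Set.sdiff_eq] at hsum
    rcases hG.ncard_le_two A (by rw [hbd, Set.ncard_pair hxy]) with h | h <;> omega

/-- A part with at most two edges does not meet the rest in two vertices of degree two. -/
theorem IsInternallyThreeConnected.two_lt_ncard [Finite V]
    (hG : G.IsInternallyThreeConnected) (hV : 6 ≤ Nat.card V) {p q : V} (hpq : p ≠ q)
    (hp : (G.neighborSet p).ncard = 2) (hq : (G.neighborSet q).ncard = 2)
    {A : Set (Sym2 V)} (hA : G.edgeBoundary A = {p, q}) : 2 < (G.edgeSet ∩ A).ncard := by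
  by_contra! hcard
  have hnadj := hG.not_adj_of_degree_two hV hp hq
  obtain ⟨⟨s, hps, hpsA⟩, -⟩ : p ∈ G.edgeBoundary A := by rw [hA]; exact Or.inl rfl
  obtain ⟨⟨t, hqt, hqtA⟩, -⟩ : q ∈ G.edgeBoundary A := by rw [hA]; exact Or.inr rfl
  have hsq : s ≠ q := by rintro rfl; exact hnadj hps
  have htp : t ≠ p := by rintro rfl; exact hnadj hqt.symm
  have hne : s(p, s) ≠ s(q, t) := by
    intro h
    rcases Sym2.eq_iff.mp h with h | h
    · exact hpq h.1
    · exact htp h.1.symm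
  have hsub : ({s(p, s), s(q, t)} : Set (Sym2 V)) ⊆ G.edgeSet ∩ A := by
    rintro e (rfl | rfl)
    · exact ⟨hps, hpsA⟩
    · exact ⟨hqt, hqtA⟩
  have heq := Set.eq_of_subset_of_ncard_le hsub (by rwa [Set.ncard_pair hne])
  -- Now `A` consists of the edges `ps` and `qt` only. Since `s` is not on the boundary, all its
  -- edges are among these two, so `s` has degree two and is adjacent to `p`, which is impossible.
  have hs : ∀ y, G.Adj s y → y = p ∨ y = q := by
    intro y hy
    have hyA : s(s, y) ∈ A := by
      by_contra hyA
      have : s ∈ G.edgeBoundary A := ⟨⟨p, hps.symm, by rwa [Sym2.eq_swap]⟩, y, hy, hyA⟩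
      rw [hA] at this
      rcases this with h | h
      · exact hps.ne h.symm
      · exact hsq h
    have : s(s, y) ∈ G.edgeSet ∩ A := ⟨hy, hyA⟩
    rw [← heq] at this
    rcases this with h | h
    · rcases Sym2.eq_iff.mp h with h | h
      · exact absurd h.1.symm hps.ne
      · exact Or.inl h.2
    · rcases Sym2.eq_iff.mp (Set.mem_singleton_iff.mp h) with h | h
      · exact absurd h.1 hsq
      · exact Or.inr h.2
  have hsN : G.neighborSet s = {p, q} := by
    obtain ⟨y, hyp, hy⟩ := hG.1.exists_adj_ne s p
    have hyq := (hs y hy).resolve_left hyp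
    refine Set.Subset.antisymm hs ?_
    rintro _ (rfl | rfl)
    · exact hps.symm
    · exact hyq ▸ hy
  exact hG.not_adj_of_degree_two hV hp (by rw [hsN, Set.ncard_pair hpq]) hps

/-- If `e` started above `c.fst`, then `c` would be the only edge leaving the vertices of level at
most `h c.fst`, and `c.fst` would separate another of its neighbours from `c.snd`. -/
theorem IsVertexConnected.le_of_two_cut [Finite V] (h2 : G.IsVertexConnected 2) {h : V → ℝ}
    {c e : G.Dart} (hce : c.fst ≠ e.fst) (hce' : c.fst ≠ e.snd)
    (hc : h c.snd = h c.fst + 1) (he : h e.snd = h e.fst + 1)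
    (hrest : ∀ d : G.Dart, d.edge ≠ c.edge → d.edge ≠ e.edge → h d.snd = h d.fst) :
    h e.fst ≤ h c.fst := by
  by_contra! hlt
  obtain ⟨w, hwc, hw⟩ := h2.exists_adj_ne c.fst c.snd
  have hwh : h w = h c.fst := by
    refine hrest ⟨(c.fst, w), hw⟩ (fun heq => ?_) (fun heq => ?_)
    · exact hwc (Sym2.congr_right.mp heq)
    · have : c.fst ∈ e.edge := heq ▸ Sym2.mem_mk_left _ _
      rcases Sym2.mem_iff.mp this with h | h
      · exact hce h
      · exact hce' h
  have := h2.forall_of_adj_of_ne (x := c.fst) (P := fun y => h y ≤ h c.fst) (y := w) hw.ne'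
    hwh.le ?_ (z := c.snd) c.adj.ne'
  · linarith
  · intro y z hy hz hyz hle
    by_cases h1 : (⟨(y, z), hyz⟩ : G.Dart).edge = e.edge
    · rcases (dart_edge_eq_iff _ _).mp h1 with h1 | h1
      · have : y = e.fst := congrArg (fun d : G.Dart => d.fst) h1
        subst this
        linarith
      · have : y = e.snd := congrArg (fun d : G.Dart => d.fst) h1
        subst this
        linarith
    · have := hrest ⟨(y, z), hyz⟩ (fun heq => ?_) h1
      · exact this.le.trans hle
      · have : c.fst ∈ s(y, z) := by
          rw [show s(y, z) = c.edge from heq]; exact Sym2.mem_mk_left _ _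
        rcases Sym2.mem_iff.mp this with h | h
        · exact hy h.symm
        · exact hz h.symm

namespace RotationSystem

variable [Finite V] {R : RotationSystem G}

/-- The two darts at a vertex of degree two follow each other. -/
theorem rot_eq_of_degree_two (h2 : G.IsVertexConnected 2) {d d' : G.Dart}
    (hdd' : d.fst = d'.fst) (hne : d ≠ d') (hdeg : (G.neighborSet d.fst).ncard = 2) :
    R.rot d = d' := by
  have hsnd : ∀ e e' : G.Dart, e.fst = e'.fst → e ≠ e' → e.snd ≠ e'.snd := fun e e' h hne h' =>
    hne (Dart.ext _ _ (Prod.ext h h'))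
  have hfst := R.rot_fst d
  refine Dart.ext _ _ (Prod.ext (hfst.trans hdd') ?_)
  refine eq_of_ncard_neighborSet_eq_two hdeg d.adj (hdd' ▸ d'.adj) (hfst ▸ (R.rot d).adj)
    (hsnd d d' hdd' hne) (hsnd _ _ hfst (R.rot_ne_self h2 d))

/-- In an internally 3-connected plane graph, two vertices of degree two have at most one face in
common. -/
theorem IsPlane.face_eq_of_incident (hR : R.IsPlane) (hG : G.IsInternallyThreeConnected)
    (hV : 6 ≤ Nat.card V) {p q : V} (hpq : p ≠ q) (hp : (G.neighborSet p).ncard = 2)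
    (hq : (G.neighborSet q).ncard = 2) {X Y : R.Face} (hpX : R.Incident p X)
    (hpY : R.Incident p Y) (hqX : R.Incident q X) (hqY : R.Incident q Y) : X = Y := by
  classical
  have := finite_dart (G := G)
  have : Fintype G.Dart := Fintype.ofFinite _
  have := hG.1.nonempty_dart
  by_contra hXY
  have hnadj := hG.not_adj_of_degree_two hV hp hq
  obtain ⟨c, hcp, hcX⟩ := hpX
  obtain ⟨c', hcp', hcY⟩ := hpY
  obtain ⟨e, heq, heY⟩ := hqY
  obtain ⟨e', heq', heX⟩ := hqX
  have hcY' : R.face c.symm = Y := by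
    rw [← face_rot, rot_eq_of_degree_two hG.1 (hcp.trans hcp'.symm) (d' := c') ?_ (hcp ▸ hp), hcY]
    rintro rfl
    exact hXY (hcX.symm.trans hcY)
  have heX' : R.face e.symm = X := by
    rw [← face_rot, rot_eq_of_degree_two hG.1 (heq.trans heq'.symm) (d' := e') ?_ (heq ▸ hq), heX]
    rintro rfl
    exact hXY (heX.symm.trans heY)
  have hcq : c.snd ≠ q := by rintro rfl; exact hnadj (hcp ▸ c.adj)
  have hep : e.snd ≠ p := by rintro rfl; exact hnadj (heq ▸ e.adj.symm)
  -- The dual closed walk from `X` to `Y` across `c` at `p` and back to `X` across `e` at `q`. It is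
  -- balanced on every face, so its potential `h` rises by one along `c` and along `e` and is
  -- constant on all other edges.
  let z : G.Dart → ℝ := fun y => ((if y = c then (1 : ℝ) else 0) - (if y = c.symm then 1 else 0)) +
    ((if y = e then (1 : ℝ) else 0) - (if y = e.symm then 1 else 0))
  have hsymm : ∀ y c : G.Dart, y.symm = c ↔ y = c.symm := fun y c =>
    ⟨fun h => by rw [← h, Dart.symm_symm], fun h => by rw [h, Dart.symm_symm]⟩
  obtain ⟨h, hh⟩ := hR.exists_potential (hG.1.connected two_pos) (z := z) (fun y => by
      simp only [z, hsymm, Dart.symm_symm]; ring) (fun F => by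
      simp only [z]
      rw [Finset.sum_add_distrib, sum_face_single_sub, sum_face_single_sub, hcX, hcY', heX', heY]
      ring)
  have hce : c ≠ e := fun h => hpq (by rw [← hcp, ← heq, h])
  have hce' : c ≠ e.symm := fun h => hcq (by rw [h, ← heq]; rfl)
  have hec' : e ≠ c.symm := fun h => hce' (by rw [h, Dart.symm_symm])
  have hc1 : h c.snd = h c.fst + 1 := by
    have := hh c
    simp only [z, hce, hce', c.symm_ne.symm, if_true, if_false] at this
    linarith
  have he1 : h e.snd = h e.fst + 1 := by
    have := hh e
    simp only [z, hce.symm, hec', e.symm_ne.symm, if_true, if_false] at this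
    linarith
  have hrest : ∀ d : G.Dart, d.edge ≠ c.edge → d.edge ≠ e.edge → h d.snd = h d.fst := by
    intro d hdc hde
    have h1 := hh d
    have hd1 : d ≠ c ∧ d ≠ c.symm :=
      not_or.mp fun h => hdc ((dart_edge_eq_iff _ _).mpr h)
    have hd2 : d ≠ e ∧ d ≠ e.symm :=
      not_or.mp fun h => hde ((dart_edge_eq_iff _ _).mpr h)
    simp only [z, hd1.1, hd1.2, hd2.1, hd2.2, if_false] at h1
    linarith
  have hpe : c.fst ≠ e.snd := fun h => hep (h.symm.trans hcp)
  have hqc : e.fst ≠ c.snd := fun h => hcq (h.symm.trans heq)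
  have hfst : c.fst ≠ e.fst := fun h => hpq (hcp.symm.trans (h.trans heq))
  have hlevel : h e.fst = h c.fst := le_antisymm
    (hG.1.le_of_two_cut hfst hpe hc1 he1 hrest)
    (hG.1.le_of_two_cut hfst.symm hqc he1 hc1 fun d h1 h2 => hrest d h2 h1)
  -- The edges on the lower side of the cut. The cut edges themselves fall into the complement, so
  -- the two sides meet exactly in their lower ends `p` and `q`.
  let A : Set (Sym2 V) := {a | ∀ x ∈ a, h x ≤ h c.fst}
  have hmemA : ∀ a b : V, s(a, b) ∈ A ↔ h a ≤ h c.fst ∧ h b ≤ h c.fst := fun a b => by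
    constructor
    · exact fun hab => ⟨hab a (Sym2.mem_mk_left _ _), hab b (Sym2.mem_mk_right _ _)⟩
    · rintro ⟨ha, hb⟩ x hx
      rcases Sym2.mem_iff.mp hx with rfl | rfl <;> assumption
  have hboth : ∀ d d' : G.Dart, d.fst ≠ d'.fst → d.fst ≠ d'.snd → h d.fst = h c.fst →
      h d.snd = h d.fst + 1 →
      (∀ a : G.Dart, a.edge ≠ d.edge → a.edge ≠ d'.edge → h a.snd = h a.fst) →
      d.fst ∈ G.edgeBoundary A := by
    intro d d' hdd hdd' hd hd1 hrest
    obtain ⟨w, hwd, hw⟩ := hG.1.exists_adj_ne d.fst d.snd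
    refine ⟨⟨w, hw, ?_⟩, d.snd, d.adj, ?_⟩
    · have hwh : h w = h d.fst := by
        refine hrest ⟨(d.fst, w), hw⟩ (fun heq => ?_) (fun heq => ?_)
        · exact hwd (Sym2.congr_right.mp heq)
        · have : d.fst ∈ d'.edge := heq ▸ Sym2.mem_mk_left _ _
          rcases Sym2.mem_iff.mp this with h | h
          · exact hdd h
          · exact hdd' h
      rw [hmemA, hwh, hd]
      exact ⟨le_rfl, le_rfl⟩
    · rw [hmemA, hd1, hd]
      rintro ⟨-, h⟩
      linarith
  have hbd : G.edgeBoundary A = {p, q} := by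
    ext w
    constructor
    · rintro ⟨⟨a, hwa, haA⟩, b, hwb, hbA⟩
      rw [hmemA] at haA hbA
      have hb : h c.fst < h b := by
        by_contra! hb
        exact hbA ⟨haA.1, hb⟩
      by_cases h1 : (⟨(w, b), hwb⟩ : G.Dart).edge = c.edge
      · rcases (dart_edge_eq_iff _ _).mp h1 with h1 | h1
        · exact Or.inl ((congrArg (fun d : G.Dart => d.fst) h1).trans hcp)
        · have : b = c.fst := congrArg (fun d : G.Dart => d.snd) h1
          rw [this] at hb
          exact absurd hb (lt_irrefl _)
      · by_cases h3 : (⟨(w, b), hwb⟩ : G.Dart).edge = e.edge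
        · rcases (dart_edge_eq_iff _ _).mp h3 with h3 | h3
          · exact Or.inr ((congrArg (fun d : G.Dart => d.fst) h3).trans heq)
          · have : b = e.fst := congrArg (fun d : G.Dart => d.snd) h3
            rw [this, hlevel] at hb
            exact absurd hb (lt_irrefl _)
        · have h4 : h b = h w := hrest ⟨(w, b), hwb⟩ h1 h3
          linarith [haA.1]
    · rintro (rfl | rfl)
      · rw [← hcp]
        exact hboth c e hfst hpe rfl hc1 hrest
      · rw [← heq]
        exact hboth e c hfst.symm hqc hlevel he1 fun d h1 h2 => hrest d h2 h1
  have h1 := hG.two_lt_ncard hV hpq hp hq hbd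
  have h3 := hG.two_lt_ncard hV hpq hp hq ((edgeBoundary_compl A).trans hbd)
  rcases hG.ncard_le_two A (by rw [hbd, Set.ncard_pair hpq]) with h | h <;> omega

end RotationSystem
end SimpleGraph

/-! ### st-numberings by ear decomposition -/

namespace SimpleGraph

variable {V : Type*} {D : SimpleGraph V}

/-- An injective numbering of the vertices in `A` such that every vertex other than `s` and `t` has
both a lower and a higher neighbour in `A`. -/
structure IsPartialNumbering (D : SimpleGraph V) (s t : V) (A : Set V) (h : V → ℝ) : Prop where
  source_mem : s ∈ A
  target_mem : t ∈ A
  lt : h s < h t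
  injOn : Set.InjOn h A
  exists_lower : ∀ x ∈ A, x ≠ s → x ≠ t → ∃ y ∈ A, D.Adj x y ∧ h y < h x
  exists_upper : ∀ x ∈ A, x ≠ s → x ≠ t → ∃ y ∈ A, D.Adj x y ∧ h x < h y

theorem IsPartialNumbering.source_le [Finite V] {s t : V} {A : Set V} {h : V → ℝ}
    (hA : D.IsPartialNumbering s t A h) {x : V} (hx : x ∈ A) : h s ≤ h x := by
  obtain ⟨m, hm, hmin⟩ := Set.exists_min_image A h (Set.toFinite A) ⟨x, hx⟩
  have hms : m = s := by
    by_contra hne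
    by_cases hmt : m = t
    · exact absurd (hmt ▸ hmin s hA.source_mem) (not_le.mpr hA.lt)
    · obtain ⟨y, hy, -, hlt⟩ := hA.exists_lower m hm hne hmt
      exact absurd (hmin y hy) (not_le.mpr hlt)
  exact hms ▸ hmin x hx

theorem IsPartialNumbering.le_target [Finite V] {s t : V} {A : Set V} {h : V → ℝ}
    (hA : D.IsPartialNumbering s t A h) {x : V} (hx : x ∈ A) : h x ≤ h t := by
  obtain ⟨m, hm, hmax⟩ := Set.exists_max_image A h (Set.toFinite A) ⟨x, hx⟩
  have hms : m = t := by
    by_contra hne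
    by_cases hmt : m = s
    · exact absurd (hmt ▸ hmax t hA.target_mem) (not_le.mpr hA.lt)
    · obtain ⟨y, hy, -, hlt⟩ := hA.exists_upper m hm hmt hne
      exact absurd (hmax y hy) (not_le.mpr hlt)
  exact hms ▸ hmax x hx

/-- An ear with ends `p` and `q` can be inserted into a partial numbering. -/
theorem IsPartialNumbering.insert_ear [Finite V] {s t : V} {A : Set V} {h : V → ℝ}
    (hA : D.IsPartialNumbering s t A h) {p q : V} (hp : p ∈ A) (hq : q ∈ A) (hpq : h p < h q)
    {n : ℕ} {g : ℕ → V} (hginj : Set.InjOn g {i | i ≤ n}) (hgA : ∀ i, g i ∉ A)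
    (hgadj : ∀ i < n, D.Adj (g i) (g (i + 1))) (hpg : D.Adj p (g 0)) (hqg : D.Adj q (g n)) :
    ∃ h', D.IsPartialNumbering s t (A ∪ g '' {i | i ≤ n}) h' := by
  classical
  obtain ⟨r, ⟨hr, hpr⟩, hmin⟩ := Set.exists_min_image {r | r ∈ A ∧ h p < h r} h (Set.toFinite _)
    ⟨q, hq, hpq⟩
  -- Increasing values strictly between `h p` and the next value `h r` in use; thus they are new,
  -- and the last ear vertex lies below `q` because `h r ≤ h q`.
  let f : ℕ → ℝ := fun i => h r - (h r - h p) / (i + 2)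
  have hf0 : ∀ i, h p < f i := by
    intro i
    have h1 : (h r - h p) / ((i : ℝ) + 2) < h r - h p := by
      rw [div_lt_iff₀ (by positivity)]
      nlinarith [(Nat.cast_nonneg i : (0 : ℝ) ≤ i)]
    simp only [f]; linarith
  have hf1 : ∀ i, f i < h r := by
    intro i
    have h1 : 0 < (h r - h p) / ((i : ℝ) + 2) := div_pos (by linarith) (by positivity)
    simp only [f]; linarith
  have hfmono : StrictMono f := by
    refine strictMono_nat_of_lt_succ fun i => ?_
    have h1 : (h r - h p) / (((i + 1 : ℕ) : ℝ) + 2) < (h r - h p) / ((i : ℝ) + 2) := by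
      apply div_lt_div_of_pos_left (by linarith) (by positivity)
      push_cast; linarith
    simp only [f]; linarith
  have hfA : ∀ i, ∀ x ∈ A, h x ≠ f i := by
    intro i x hx heq
    have h1 := hmin x ⟨hx, heq ▸ hf0 i⟩
    have h2 := hf1 i
    linarith
  let h' : V → ℝ := fun y => if y ∈ A then h y else f (Function.invFunOn g {i | i ≤ n} y)
  have hh'A : ∀ x ∈ A, h' x = h x := fun x hx => if_pos hx
  have hh'g : ∀ i ≤ n, h' (g i) = f i := fun i hi => by
    rw [show h' (g i) = _ from if_neg (hgA i), hginj.leftInvOn_invFunOn hi]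
  have hg : ∀ i ≤ n, g i ∈ A ∪ g '' {i | i ≤ n} := fun i hi => Or.inr ⟨i, hi, rfl⟩
  refine ⟨h', Or.inl hA.source_mem, Or.inl hA.target_mem, ?_, ?_, ?_, ?_⟩
  · rw [hh'A _ hA.source_mem, hh'A _ hA.target_mem]; exact hA.lt
  · rintro x (hx | ⟨i, hi, rfl⟩) y (hy | ⟨j, hj, rfl⟩) hxy
    · rw [hh'A x hx, hh'A y hy] at hxy
      exact hA.injOn hx hy hxy
    · rw [hh'A x hx, hh'g j hj] at hxy
      exact absurd hxy (hfA j x hx)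
    · rw [hh'A y hy, hh'g i hi] at hxy
      exact absurd hxy.symm (hfA i y hy)
    · rw [hh'g i hi, hh'g j hj] at hxy
      rw [hfmono.injective hxy]
  · rintro x (hx | ⟨i, hi, rfl⟩) hxs hxt
    · obtain ⟨y, hy, hadj, hlt⟩ := hA.exists_lower x hx hxs hxt
      exact ⟨y, Or.inl hy, hadj, by rwa [hh'A x hx, hh'A y hy]⟩
    · cases i with
      | zero => exact ⟨p, Or.inl hp, hpg.symm, by rw [hh'A p hp, hh'g 0 hi]; exact hf0 0⟩
      | succ i =>
        have hi' : i + 1 ≤ n := hi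
        refine ⟨g i, hg i (by omega), (hgadj i (by omega)).symm, ?_⟩
        rw [hh'g i (by omega), hh'g (i + 1) hi']
        exact hfmono (Nat.lt_succ_self i)
  · rintro x (hx | ⟨i, hi, rfl⟩) hxs hxt
    · obtain ⟨y, hy, hadj, hlt⟩ := hA.exists_upper x hx hxs hxt
      exact ⟨y, Or.inl hy, hadj, by rwa [hh'A x hx, hh'A y hy]⟩
    · have hi' : i ≤ n := hi
      rcases hi'.lt_or_eq with hlt | rfl
      · refine ⟨g (i + 1), hg (i + 1) hlt, hgadj i hlt, ?_⟩
        rw [hh'g i hi', hh'g (i + 1) hlt]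
        exact hfmono (Nat.lt_succ_self i)
      · refine ⟨q, Or.inl hq, hqg.symm, ?_⟩
        rw [hh'A q hq, hh'g i hi']
        exact (hf1 i).trans_le (hmin q ⟨hq, hpq⟩)

/-- A component outside `A` is attached to at least two vertices of `A`, for a single one would be a
cut vertex. A path through the component between two attachments is an ear, and injectivity orders
its ends. -/
theorem IsPartialNumbering.exists_extension [Finite V] (hc : D.Connected)
    (hcut : ∀ x, (D.induce {x}ᶜ).Preconnected) {s t : V} {A : Set V} {h : V → ℝ}
    (hA : D.IsPartialNumbering s t A h) {x : V} (hx : x ∉ A) :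
    ∃ A' h', A ⊂ A' ∧ D.IsPartialNumbering s t A' h' := by
  classical
  let C : Set V := {y | ∃ hy : y ∈ Aᶜ, (D.induce Aᶜ).Reachable ⟨x, hx⟩ ⟨y, hy⟩}
  have hxC : x ∈ C := ⟨hx, .refl _⟩
  have hCA : ∀ y ∈ C, y ∉ A := fun y hy => hy.1
  have hstep : ∀ y ∈ C, ∀ z, D.Adj y z → z ∉ A → z ∈ C := by
    rintro y ⟨hy, hr⟩ z hyz hz
    exact ⟨hz, hr.trans 
      (show (D.induce Aᶜ).Adj ⟨y, hy⟩ ⟨z, hz⟩ from hyz).reachable⟩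
  obtain ⟨p, hp, c, hcC, hpc⟩ : ∃ p ∈ A, ∃ c ∈ C, D.Adj p c := by
    by_contra! hno
    refine hCA s ?_ hA.source_mem
    refine RotationSystem.forall_of_adj hc (P := fun y => y ∈ C) hxC (fun y z hyz hy => ?_) s
    exact hstep y hy z hyz fun hz => hno z hz y hy hyz.symm
  obtain ⟨q, hq, hqp, e, heC, hqe⟩ : ∃ q ∈ A, q ≠ p ∧ ∃ e ∈ C, D.Adj q e := by
    by_contra! hno
    obtain ⟨w, hwA, hwp⟩ : ∃ w ∈ A, w ≠ p := by
      by_cases hsp : s = p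
      · exact ⟨t, hA.target_mem, fun h => hA.lt.ne (by rw [hsp, h])⟩
      · exact ⟨s, hA.source_mem, hsp⟩
    have hxp : x ≠ p := fun h => hx (h ▸ hp)
    have : Nonempty ↥({p}ᶜ : Set V) := ⟨⟨x, hxp⟩⟩
    have hconn : (D.induce {p}ᶜ).Connected := ⟨hcut p⟩
    refine hCA w ?_ hwA
    refine RotationSystem.forall_of_adj hconn (P := fun y => y.1 ∈ C) (x := ⟨x, hxp⟩) hxC
      (fun y z hyz hy => ?_) ⟨w, hwp⟩
    exact hstep y hy z hyz fun hz => hno z hz z.2 y hy hyz.symm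
  have hear : ∀ p ∈ A, ∀ q ∈ A, h p < h q → ∀ c ∈ C, ∀ e ∈ C, D.Adj p c → D.Adj q e →
      ∃ A' h', A ⊂ A' ∧ D.IsPartialNumbering s t A' h' := by
    rintro p hp q hq hpq c ⟨hcA, hcr⟩ e ⟨heA, her⟩ hpc hqe
    obtain ⟨W, hW⟩ := (hcr.symm.trans her).exists_isPath
    obtain ⟨h', hh'⟩ := hA.insert_ear hp hq hpq (n := W.length) (g := fun i => (W.getVert i).1)
      (fun i hi j hj hij => hW.getVert_injOn hi hj (Subtype.ext hij))
      (fun i => (W.getVert i).2) (fun i hi => W.adj_getVert_succ hi)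
      (by simpa using hpc) (by simpa using hqe)
    refine ⟨_, h', ?_, hh'⟩
    refine ⟨Set.subset_union_left, fun hsub => hcA (hsub (Or.inr ?_))⟩
    exact ⟨0, Nat.zero_le _, by simp⟩
  rcases lt_or_gt_of_ne (hA.injOn.ne hq hp hqp) with hlt | hlt
  · exact hear q hq p hp hlt e heC c hcC hqe hpc
  · exact hear p hp q hq hlt c hcC e heC hpc hqe

/-- Every graph without a cut vertex has an `st`-numbering. -/
theorem exists_st_numbering [Finite V] (hc : D.Connected)
    (hcut : ∀ x, (D.induce {x}ᶜ).Preconnected) {s t : V} (hst : s ≠ t) :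
    ∃ h : V → ℕ, Function.Injective h ∧ h s = 0 ∧ (∀ x ≠ s, ∃ y, D.Adj x y ∧ h y < h x) ∧
      ∀ x ≠ t, ∃ y, D.Adj x y ∧ h x < h y := by
  classical
  have hstart : D.IsPartialNumbering s t {s, t} (fun x => if x = s then 0 else 1) := by
    refine ⟨Or.inl rfl, Or.inr rfl, ?_, ?_, ?_, ?_⟩
    · simp [hst.symm]
    · rintro x (rfl | rfl) y (rfl | rfl) hxy
      · rfl
      · simp [hst.symm] at hxy
      · simp [hst.symm] at hxy
      · rfl
    · rintro x (rfl | rfl) h1 h2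
      · exact absurd rfl h1
      · exact absurd rfl h2
    · rintro x (rfl | rfl) h1 h2
      · exact absurd rfl h1
      · exact absurd rfl h2
  obtain ⟨A, ⟨h, hA⟩, hmax⟩ := (Set.toFinite {A | ∃ h, D.IsPartialNumbering s t A h}).exists_maximal
    ⟨_, _, hstart⟩
  have hall : ∀ x, x ∈ A := by
    by_contra! hno
    obtain ⟨x, hx⟩ := hno
    obtain ⟨A', h', hlt, hA'⟩ := hA.exists_extension hc hcut hx
    exact hlt.2 (hmax ⟨h', hA'⟩ hlt.1)
  have hinj : Function.Injective h := fun x y hxy => hA.injOn (hall x) (hall y) hxy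
  -- The real numbering is replaced by ranks, so that `s` gets `0`.
  let k : V → ℕ := fun x => {y | h y < h x}.ncard
  have hk : ∀ {x y}, h x < h y → k x < k y := fun {x y} hxy =>
    Set.ncard_lt_ncard ⟨fun z hz => lt_trans hz hxy, fun hsub => lt_irrefl (h x) (hsub hxy)⟩
  have hnbr : ∀ x, ∃ y, D.Adj x y := by
    intro x
    by_contra! hno
    have hone : ∀ y, y = x := RotationSystem.forall_of_adj hc (P := fun y => y = x) rfl
      fun y z hyz hy => absurd hyz (hy ▸ hno z)
    exact hst ((hone s).trans (hone t).symm)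
  refine ⟨k, fun x y hxy => ?_, ?_, fun x hx => ?_, fun x hx => ?_⟩
  · by_contra hne
    rcases lt_or_gt_of_ne (hinj.ne hne) with hlt | hlt
    · exact (hk hlt).ne hxy
    · exact (hk hlt).ne hxy.symm
  · have : {y | h y < h s} = ∅ :=
      Set.eq_empty_of_forall_notMem fun y hy => absurd hy (not_lt.mpr (hA.source_le (hall y)))
    simp only [k, this, Set.ncard_empty]
  · by_cases hxt : x = t
    · obtain ⟨y, hy⟩ := hnbr x
      refine ⟨y, hy, hk (lt_of_le_of_ne ?_ (hinj.ne hy.ne'))⟩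
      rw [hxt]; exact hA.le_target (hall y)
    · obtain ⟨y, -, hadj, hlt⟩ := hA.exists_lower x (hall x) hx hxt
      exact ⟨y, hadj, hk hlt⟩
  · by_cases hxs : x = s
    · obtain ⟨y, hy⟩ := hnbr x
      refine ⟨y, hy, hk (lt_of_le_of_ne ?_ (hinj.ne hy.ne))⟩
      rw [hxs]; exact hA.source_le (hall y)
    · obtain ⟨y, -, hadj, hlt⟩ := hA.exists_upper x (hall x) hxs hx
      exact ⟨y, hadj, hk hlt⟩

namespace RotationSystem

variable [Finite V] {G : SimpleGraph V} {R : RotationSystem G}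

theorem IsPlane.dualGraph_connected (hR : R.IsPlane) (h2 : G.IsVertexConnected 2) :
    R.dualGraph.Connected := by
  obtain ⟨d₀⟩ := h2.nonempty_dart
  have key : ∀ d, R.dualGraph.Reachable (R.face d₀) (R.face d) := by
    have hadj : ∀ d, R.dualGraph.Adj (R.face d) (R.face d.symm) := fun d =>
      ⟨(hR.face_symm_ne h2 d).symm, d, rfl, rfl⟩
    refine R.forall_dart_of_connected (h2.connected two_pos) (d := d₀) (.refl _)
      (fun d hd => hd.trans (hadj d).reachable) fun d hd => ?_
    rw [face_rot]
    exact hd.trans (hadj d).reachable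
  have : Nonempty R.Face := ⟨R.face d₀⟩
  refine ⟨fun F F' => ?_⟩
  obtain ⟨d, rfl⟩ := R.face_surjective F
  obtain ⟨d', rfl⟩ := R.face_surjective F'
  exact (key d).symm.trans (key d')

theorem IsPlane.dualGraph_induce_preconnected (hR : R.IsPlane) (h2 : G.IsVertexConnected 2)
    (X : R.Face) : (R.dualGraph.induce {X}ᶜ).Preconnected := by
  intro F F'
  obtain ⟨h, hr⟩ : F'.1 ∈ {Y | ∃ hY : Y ∈ ({X}ᶜ : Set R.Face),
      (R.dualGraph.induce {X}ᶜ).Reachable F ⟨Y, hY⟩} := by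
    refine hR.forall_face_of_dualAdj h2 (X := X) (F₀ := F.1) F.2 ?_ ?_ F'.2
    · exact ⟨F.2, .refl _⟩
    rintro Y Z hY hZ hYZ ⟨hY', hr⟩
    exact ⟨hZ, hr.trans 
      (show (R.dualGraph.induce {X}ᶜ).Adj ⟨Y, hY'⟩ ⟨Z, hZ⟩ from hYZ).reachable⟩
  exact hr

end RotationSystem
end SimpleGraph

/-! ### Tight solutions of covering inequalities and clearing of denominators -/

/-- The covering inequalities `r x ≤ ∑ j, D j x * α j` have a positive solution in which no `α i` can
be lowered, provided that the coefficients vanish only at `x₀` and at distinct points `U j`. -/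
theorem exists_tight_coefficients {ι : Type*} [Finite ι] (r : ι → ℕ) (D : Fin 3 → ι → ℕ) (x₀ : ι)
    (U : Fin 3 → ι) (hr : ∀ x, r x = 0 ↔ x = x₀) (hD : ∀ j x, D j x = 0 ↔ x = x₀ ∨ x = U j)
    (hU : Function.Injective U) (hU₀ : ∀ j, U j ≠ x₀) :
    ∃ α : Fin 3 → ℚ, (∀ j, 0 < α j) ∧ (∀ x, (r x : ℚ) ≤ ∑ j, D j x * α j) ∧
      ∀ i, ∃ x, 0 < D i x ∧ ∑ j, D j x * α j = r x := by
  have hpos : ∀ {i j}, i ≠ j → 0 < D i (U j) := fun {i j} hij =>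
    Nat.pos_of_ne_zero fun h => ((hD _ _).mp h).elim (hU₀ j) fun h => hij (hU h).symm
  have hrpos : ∀ j, (1 : ℚ) ≤ r (U j) := fun j => by
    exact_mod_cast Nat.one_le_iff_ne_zero.mpr fun h => hU₀ j ((hr _).mp h)
  have h01 : (0 : ℚ) < D 0 (U 1) := by exact_mod_cast hpos (by decide)
  have h10 : (0 : ℚ) < D 1 (U 0) := by exact_mod_cast hpos (by decide)
  -- The third coefficient, so small that it contributes less than `1`, hence less than `r`, at `U
  -- 0` and at `U 1`.
  set δ : ℚ := 1 / (1 + D 2 (U 0) + D 2 (U 1)) with hδ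
  have hδpos : 0 < δ := by positivity
  have hδ0 : δ * D 2 (U 0) < 1 := by
    rw [hδ, one_div, inv_mul_lt_iff₀ (by positivity)]
    linarith [(Nat.cast_nonneg (D 2 (U 1)) : (0 : ℚ) ≤ _)]
  have hδ1 : δ * D 2 (U 1) < 1 := by
    rw [hδ, one_div, inv_mul_lt_iff₀ (by positivity)]
    linarith [(Nat.cast_nonneg (D 2 (U 0)) : (0 : ℚ) ≤ _)]
  -- The first coefficient makes the inequality at `U 1` tight; the second plays no role there
  -- because `D 1 (U 1) = 0`.
  set α₀ : ℚ := (r (U 1) - δ * D 2 (U 1)) / D 0 (U 1) with hα₀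
  have hα₀pos : 0 < α₀ := div_pos (by linarith [hrpos 1]) h01
  have hα₀eq : D 0 (U 1) * α₀ = r (U 1) - δ * D 2 (U 1) := mul_div_cancel₀ _ h01.ne'
  -- The lower bound that the inequality at `x` imposes on the second coefficient. Its maximum is
  -- taken, which is tight at `m` and positive because the bound at `U 0`, where `D 0` vanishes, is
  -- positive. Tightness at `U 1` serves the first and third coefficients.
  let f : ι → ℚ := fun x => (r x - α₀ * D 0 x - δ * D 2 x) / D 1 x
  obtain ⟨m, hm, hmax⟩ := Set.exists_max_image {x | 0 < D 1 x} f (Set.toFinite _)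
    ⟨U 0, hpos (by decide)⟩
  have hD00 : (D 0 (U 0) : ℚ) = 0 := by exact_mod_cast (hD 0 (U 0)).mpr (Or.inr rfl)
  have hfm : 0 < f m := by
    refine lt_of_lt_of_le ?_ (hmax (U 0) (hpos (by decide)))
    refine div_pos ?_ h10
    rw [hD00]
    linarith [hrpos 0]
  have htight1 : ∑ j, (D j (U 1) : ℚ) * ![α₀, f m, δ] j = r (U 1) := by
    have : (D 1 (U 1) : ℚ) = 0 := by exact_mod_cast (hD 1 (U 1)).mpr (Or.inr rfl)
    simp only [Fin.sum_univ_three, Matrix.cons_val_zero, Matrix.cons_val_one, Matrix.cons_val]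
    rw [this, hα₀eq]
    ring
  refine ⟨![α₀, f m, δ], fun j => ?_, fun x => ?_, fun i => ?_⟩
  · fin_cases j
    · exact hα₀pos
    · exact hfm
    · exact hδpos
  · rcases Nat.eq_zero_or_pos (D 1 x) with h0 | h0
    · rcases (hD 1 x).mp h0 with rfl | rfl
      · rw [(hr x).mpr rfl, Nat.cast_zero]
        refine Finset.sum_nonneg fun j _ => mul_nonneg (Nat.cast_nonneg _) ?_
        fin_cases j
        · exact hα₀pos.le
        · exact hfm.le
        · exact hδpos.le
      · exact htight1.ge
    · have h1 : f x ≤ f m := hmax x h0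
      have h0' : (0 : ℚ) < D 1 x := by exact_mod_cast h0
      rw [div_le_iff₀ h0'] at h1
      simp only [Fin.sum_univ_three, Matrix.cons_val_zero, Matrix.cons_val_one, Matrix.cons_val]
      linarith
  · have htightm : ∑ j, (D j m : ℚ) * ![α₀, f m, δ] j = r m := by
      have h0' : (0 : ℚ) < D 1 m := by exact_mod_cast hm
      have h1 : D 1 m * f m = r m - α₀ * D 0 m - δ * D 2 m := mul_div_cancel₀ _ h0'.ne'
      simp only [Fin.sum_univ_three, Matrix.cons_val_zero, Matrix.cons_val_one, Matrix.cons_val]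
      rw [h1]
      ring
    fin_cases i
    · exact ⟨U 1, hpos (by decide), htight1⟩
    · exact ⟨m, hm, htightm⟩
    · exact ⟨U 1, hpos (by decide), htight1⟩

theorem exists_common_denominator {ι : Type*} [Fintype ι] (α : ι → ℚ) (hα : ∀ i, 0 < α i) :
    ∃ n : ℕ, 0 < n ∧ ∃ β : ι → ℕ, (∀ i, 0 < β i) ∧ ∀ i, (β i : ℚ) = n * α i := by
  classical
  refine ⟨∏ i, (α i).den, Finset.prod_pos fun i _ => (α i).den_pos,
    fun i => (∏ j ∈ Finset.univ.erase i, (α j).den) * (α i).num.toNat, fun i => ?_, fun i => ?_⟩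
  · refine Nat.mul_pos (Finset.prod_pos fun j _ => (α j).den_pos) ?_
    have := Rat.num_pos.mpr (hα i)
    omega
  · have h1 : (((α i).num.toNat : ℕ) : ℚ) = (α i).num := by
      exact_mod_cast Int.toNat_of_nonneg (Rat.num_pos.mpr (hα i)).le
    rw [← Finset.mul_prod_erase Finset.univ (fun j => (α j).den) (Finset.mem_univ i)]
    push_cast
    rw [h1, mul_right_comm, mul_comm _ (α i), Rat.mul_den_eq_num, mul_comm]

theorem Nat.sInf_mul_left {s : Set ℕ} (hs : s.Nonempty) (n : ℕ) :
    sInf {k | ∃ m ∈ s, n * m = k} = n * sInf s := by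
  refine le_antisymm (Nat.sInf_le ⟨_, Nat.sInf_mem hs, rfl⟩) ?_
  obtain ⟨m, hm, hk⟩ := Nat.sInf_mem (s := {k | ∃ m ∈ s, n * m = k})
    ⟨_, _, Nat.sInf_mem hs, rfl⟩
  rw [← hk]
  exact Nat.mul_le_mul_left n (Nat.sInf_le hm)

/-! ### Weighted distances in the dual and balanced weights -/

namespace SimpleGraph
namespace RotationSystem

variable {V : Type*} {G : SimpleGraph V} {R : RotationSystem G}

theorem IsDualWalk.append {F F' F'' : R.Face} {l l' : List G.Dart} (h : R.IsDualWalk F l F')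
    (h' : R.IsDualWalk F' l' F'') : R.IsDualWalk F (l ++ l') F'' := by
  induction l generalizing F with
  | nil => cases h; exact h'
  | cons d l ih => exact ⟨h.1, ih h.2⟩

theorem dualLength_cons (w : Sym2 V → ℕ) (d : G.Dart) (l : List G.Dart) :
    dualLength w (d :: l) = w d.edge + dualLength w l := by
  simp [dualLength]

theorem dualLength_mul (w : Sym2 V → ℕ) (n : ℕ) (l : List G.Dart) :
    dualLength (fun e => n * w e) l = n * dualLength w l := by
  simp [dualLength, List.sum_map_mul_left]

theorem exists_isDualWalk (hc : R.dualGraph.Connected) (F F' : R.Face) :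
    ∃ l, R.IsDualWalk F l F' := by
  refine forall_of_adj hc (P := fun F' => ∃ l, R.IsDualWalk F l F') ⟨[], rfl⟩ ?_ F'
  rintro Y Z ⟨-, d, hY, hZ⟩ ⟨l, hl⟩
  exact ⟨l ++ [d], hl.append ⟨hY, hZ⟩⟩

theorem exists_dualLength_eq_faceDist (hc : R.dualGraph.Connected) (w : Sym2 V → ℕ)
    (F F' : R.Face) : ∃ l, R.IsDualWalk F l F' ∧ dualLength w l = R.faceDist w F F' := by
  obtain ⟨l, hl⟩ := exists_isDualWalk hc F F'
  exact Nat.sInf_mem (s := {n | ∃ l, R.IsDualWalk F l F' ∧ dualLength w l = n}) ⟨_, l, hl, rfl⟩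

theorem faceDist_le (w : Sym2 V → ℕ) {F F' : R.Face} {l : List G.Dart}
    (hl : R.IsDualWalk F l F') : R.faceDist w F F' ≤ dualLength w l :=
  Nat.sInf_le ⟨l, hl, rfl⟩

theorem faceDist_eq_zero_iff (hc : R.dualGraph.Connected) {w : Sym2 V → ℕ}
    (hw : ∀ e ∈ G.edgeSet, 0 < w e) {F F' : R.Face} : R.faceDist w F F' = 0 ↔ F = F' := by
  constructor
  · intro h
    obtain ⟨l, hl, hlen⟩ := exists_dualLength_eq_faceDist hc w F F'
    cases l with
    | nil => exact hl
    | cons d l =>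
      rw [h, dualLength_cons] at hlen
      have := hw _ d.edge_mem
      omega
  · rintro rfl
    exact Nat.le_zero.mp (faceDist_le w (l := []) rfl)

theorem vertexDist_eq_zero_iff (hc : R.dualGraph.Connected) {w : Sym2 V → ℕ}
    (hw : ∀ e ∈ G.edgeSet, 0 < w e) {x : V} (hx : ∃ F, R.Incident x F) {F : R.Face} :
    R.vertexDist w x F = 0 ↔ R.Incident x F := by
  constructor
  · intro h
    obtain ⟨F₀, hF₀⟩ := hx
    obtain ⟨F', hF', hdist⟩ := Nat.sInf_mem
      (s := {n | ∃ F', R.Incident x F' ∧ R.faceDist w F' F = n}) ⟨_, F₀, hF₀, rfl⟩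
    change R.faceDist w F' F = R.vertexDist w x F at hdist
    rw [h, faceDist_eq_zero_iff hc hw] at hdist
    exact hdist ▸ hF'
  · intro h
    exact Nat.le_zero.mp (Nat.sInf_le ⟨F, h, (faceDist_eq_zero_iff hc hw).mpr rfl⟩)

theorem faceDist_mul (hc : R.dualGraph.Connected) (w : Sym2 V → ℕ) (n : ℕ) (F F' : R.Face) :
    R.faceDist (fun e => n * w e) F F' = n * R.faceDist w F F' := by
  obtain ⟨l, hl⟩ := exists_isDualWalk hc F F'
  have hne : {n | ∃ l, R.IsDualWalk F l F' ∧ dualLength w l = n}.Nonempty := ⟨_, l, hl, rfl⟩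
  rw [faceDist, faceDist, ← Nat.sInf_mul_left hne]
  congr 1
  ext k
  constructor
  · rintro ⟨l, hl, rfl⟩
    exact ⟨_, ⟨l, hl, rfl⟩, (dualLength_mul w n l).symm⟩
  · rintro ⟨_, ⟨l, hl, rfl⟩, rfl⟩
    exact ⟨l, hl, dualLength_mul w n l⟩

theorem vertexDist_mul (hc : R.dualGraph.Connected) (w : Sym2 V → ℕ) (n : ℕ) {x : V}
    (hx : ∃ F, R.Incident x F) (F : R.Face) :
    R.vertexDist (fun e => n * w e) x F = n * R.vertexDist w x F := by
  obtain ⟨F₀, hF₀⟩ := hx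
  have hne : {n | ∃ F', R.Incident x F' ∧ R.faceDist w F' F = n}.Nonempty := ⟨_, F₀, hF₀, rfl⟩
  rw [vertexDist, vertexDist, ← Nat.sInf_mul_left hne]
  congr 1
  ext k
  constructor
  · rintro ⟨F', hF', rfl⟩
    exact ⟨_, ⟨F', hF', rfl⟩, (faceDist_mul hc w n F' F).symm⟩
  · rintro ⟨_, ⟨F', hF', rfl⟩, rfl⟩
    exact ⟨F', hF', faceDist_mul hc w n F' F⟩

theorem IsBalanced.mul (hc : R.dualGraph.Connected) {w : Sym2 V → ℕ} {F F' : R.Face}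
    (h : R.IsBalanced w F F') (n : ℕ) : R.IsBalanced (fun e => n * w e) F F' := by
  intro e he
  obtain ⟨l, hl, hlen, hd⟩ := h e he
  exact ⟨l, hl, by rw [dualLength_mul, hlen, faceDist_mul hc], hd⟩

section Potential

variable {h : R.Face → ℕ} {w : Sym2 V → ℕ}

/-- The numbering is a 1-Lipschitz potential for the weights, so it bounds lengths of walks from
below; increasing walks attain the bound. -/
theorem IsDualWalk.le_add_dualLength
    (hw : ∀ d : G.Dart, w d.edge = Nat.dist (h (R.face d)) (h (R.face d.symm)))
    {F F' : R.Face} {l : List G.Dart} (hl : R.IsDualWalk F l F') :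
    h F' ≤ h F + dualLength w l := by
  induction l generalizing F with
  | nil => cases hl; exact Nat.le_add_right _ _
  | cons d l ih =>
    have h1 := ih hl.2
    have h2 := hw d
    rw [hl.1, Nat.dist] at h2
    rw [dualLength_cons]
    omega

theorem IsDualWalk.dualLength_eq_of_monotone
    (hw : ∀ d : G.Dart, w d.edge = Nat.dist (h (R.face d)) (h (R.face d.symm)))
    {F F' : R.Face} {l : List G.Dart} (hl : R.IsDualWalk F l F')
    (hmono : ∀ d ∈ l, h (R.face d) < h (R.face d.symm)) :
    h F + dualLength w l = h F' := by
  induction l generalizing F with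
  | nil => cases hl; rfl
  | cons d l ih =>
    have h1 := ih hl.2 fun e he => hmono e (List.mem_cons_of_mem _ he)
    have h2 := hw d
    have h3 := hmono d List.mem_cons_self
    rw [hl.1] at h2 h3
    rw [Nat.dist] at h2
    rw [dualLength_cons]
    omega

theorem IsDualWalk.nodup_of_monotone {F F' : R.Face} {l : List G.Dart}
    (hl : R.IsDualWalk F l F') (hmono : ∀ d ∈ l, h (R.face d) < h (R.face d.symm)) :
    (F :: l.map fun d => R.face d.symm).Nodup ∧
      ∀ Y ∈ l.map fun d => R.face d.symm, h F < h Y := by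
  induction l generalizing F with
  | nil => simp
  | cons d l ih =>
    obtain ⟨h1, h2⟩ := ih hl.2 fun e he => hmono e (List.mem_cons_of_mem _ he)
    have h3 := hmono d List.mem_cons_self
    rw [hl.1] at h3
    have h4 : ∀ Y ∈ (d :: l).map fun d => R.face d.symm, h F < h Y := by
      intro Y hY
      rw [List.map_cons] at hY
      rcases List.mem_cons.mp hY with rfl | hY
      · exact h3
      · exact h3.trans (h2 Y hY)
    exact ⟨List.nodup_cons.mpr ⟨fun hF => lt_irrefl _ (h4 F hF), h1⟩, h4⟩

variable [Finite V]

theorem exists_monotone_walk_to {t : R.Face}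
    (hup : ∀ F ≠ t, ∃ F', R.dualGraph.Adj F F' ∧ h F < h F') (F : R.Face) :
    ∃ l, R.IsDualWalk F l t ∧ ∀ d ∈ l, h (R.face d) < h (R.face d.symm) := by
  have := R.finite_face
  by_contra hF
  obtain ⟨m, hm, hmax⟩ := Set.exists_max_image
    {F | ¬ ∃ l, R.IsDualWalk F l t ∧ ∀ d ∈ l, h (R.face d) < h (R.face d.symm)} h
    (Set.toFinite _) ⟨F, hF⟩
  have hmt : m ≠ t := by
    rintro rfl
    exact hm ⟨[], rfl, by simp⟩
  obtain ⟨F', ⟨-, d, hdm, hdF'⟩, hlt⟩ := hup m hmt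
  -- `m` is a highest face without an increasing walk to `t`, so its higher neighbour has one.
  have hF' : ∃ l, R.IsDualWalk F' l t ∧ ∀ d ∈ l, h (R.face d) < h (R.face d.symm) := by
    by_contra hF'
    exact absurd (hmax F' hF') (not_le.mpr hlt)
  obtain ⟨l, hl, hmono⟩ := hF'
  refine hm ⟨d :: l, ⟨hdm, hdF' ▸ hl⟩, fun e he => ?_⟩
  rcases List.mem_cons.mp he with rfl | he
  · rwa [hdF', hdm]
  · exact hmono e he

theorem exists_monotone_walk_from {s : R.Face}
    (hdown : ∀ F ≠ s, ∃ F', R.dualGraph.Adj F F' ∧ h F' < h F) (F : R.Face) :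
    ∃ l, R.IsDualWalk s l F ∧ ∀ d ∈ l, h (R.face d) < h (R.face d.symm) := by
  have := R.finite_face
  by_contra hF
  obtain ⟨m, hm, hmin⟩ := Set.exists_min_image
    {F | ¬ ∃ l, R.IsDualWalk s l F ∧ ∀ d ∈ l, h (R.face d) < h (R.face d.symm)} h
    (Set.toFinite _) ⟨F, hF⟩
  have hms : m ≠ s := by
    rintro rfl
    exact hm ⟨[], rfl, by simp⟩
  obtain ⟨F', hadj, hlt⟩ := hdown m hms
  obtain ⟨-, d, hdF', hdm⟩ := hadj.symm
  have hF' : ∃ l, R.IsDualWalk s l F' ∧ ∀ d ∈ l, h (R.face d) < h (R.face d.symm) := by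
    by_contra hF'
    exact absurd (hmin F' hF') (not_le.mpr hlt)
  obtain ⟨l, hl, hmono⟩ := hF'
  refine hm ⟨l ++ [d], hl.append ⟨hdF', hdm⟩, fun e he => ?_⟩
  rcases List.mem_append.mp he with he | he
  · exact hmono e he
  · rw [List.mem_singleton.mp he]
    rwa [hdF', hdm]

/-- The differences of an `st`-numbering of the dual are balanced weights. -/
theorem isBalanced_of_numbering (hinj : Function.Injective h)
    (hne : ∀ d, R.face d.symm ≠ R.face d) {s t : R.Face} (hs : h s = 0)
    (hdown : ∀ F ≠ s, ∃ F', R.dualGraph.Adj F F' ∧ h F' < h F)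
    (hup : ∀ F ≠ t, ∃ F', R.dualGraph.Adj F F' ∧ h F < h F')
    (hw : ∀ d : G.Dart, w d.edge = Nat.dist (h (R.face d)) (h (R.face d.symm))) :
    R.IsBalanced w s t := by
  -- No walk from `s` to `t` is shorter than `h t`. An increasing walk through a given edge has
  -- exactly this length and, visiting no face twice, is a path.
  have hlow : ∀ l, R.IsDualWalk s l t → h t ≤ dualLength w l := fun l hl => by
    have := hl.le_add_dualLength hw
    omega
  have hdart : ∀ d : G.Dart, h (R.face d) < h (R.face d.symm) →
      ∃ l : List G.Dart, R.IsDualPath s l t ∧ dualLength w l = R.faceDist w s t ∧ d ∈ l := by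
    intro d hd
    obtain ⟨l₁, hl₁, hm₁⟩ := exists_monotone_walk_from hdown (R.face d)
    obtain ⟨l₂, hl₂, hm₂⟩ := exists_monotone_walk_to hup (R.face d.symm)
    have hl : R.IsDualWalk s (l₁ ++ d :: l₂) t := hl₁.append ⟨rfl, hl₂⟩
    have hm : ∀ e ∈ l₁ ++ d :: l₂, h (R.face e) < h (R.face e.symm) := by
      intro e he
      rcases List.mem_append.mp he with he | he
      · exact hm₁ e he
      · rcases List.mem_cons.mp he with rfl | he
        · exact hd
        · exact hm₂ e he
    refine ⟨l₁ ++ d :: l₂, ⟨hl, (hl.nodup_of_monotone hm).1⟩, ?_, by simp⟩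
    refine le_antisymm ?_ (faceDist_le w hl)
    have h1 := hl.dualLength_eq_of_monotone hw hm
    obtain ⟨l, hl', hlen⟩ := Nat.sInf_mem
      (s := {n | ∃ l, R.IsDualWalk s l t ∧ dualLength w l = n}) ⟨_, _, hl, rfl⟩
    change _ = R.faceDist w s t at hlen
    have := hlow l hl'
    omega
  intro e he
  induction e with
  | _ x y =>
    let d : G.Dart := ⟨(x, y), he⟩
    rcases lt_or_gt_of_ne (hinj.ne (hne d)) with hlt | hlt
    · obtain ⟨l, hl, hlen, hd⟩ := hdart d.symm (by rwa [Dart.symm_symm])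
      exact ⟨l, hl, hlen, d.symm, hd, d.edge_symm⟩
    · obtain ⟨l, hl, hlen, hd⟩ := hdart d hlt
      exact ⟨l, hl, hlen, d, hd, rfl⟩

end Potential

theorem exists_edge_weight (R : RotationSystem G) (h : R.Face → ℕ) :
    ∃ w : Sym2 V → ℕ, ∀ d : G.Dart, w d.edge = Nat.dist (h (R.face d)) (h (R.face d.symm)) := by
  classical
  refine ⟨fun e => if he : ∃ d : G.Dart, d.edge = e then
    Nat.dist (h (R.face he.choose)) (h (R.face he.choose.symm)) else 0, fun d => ?_⟩
  have he : ∃ d' : G.Dart, d'.edge = d.edge := ⟨d, rfl⟩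
  beta_reduce
  rw [dif_pos he]
  rcases (dart_edge_eq_iff _ _).mp he.choose_spec with h1 | h1
  · rw [h1]
  · rw [h1, Dart.symm_symm, Nat.dist_comm]

variable [Finite V]

/-- A 2-connected plane graph has positive weights that are balanced between two given faces. -/
theorem IsPlane.exists_balanced_weight (hR : R.IsPlane) (h2 : G.IsVertexConnected 2)
    {s t : R.Face} (hst : s ≠ t) :
    ∃ w : Sym2 V → ℕ, (∀ e ∈ G.edgeSet, 0 < w e) ∧ R.IsBalanced w s t := by
  have := R.finite_face
  obtain ⟨h, hinj, hs, hdown, hup⟩ := exists_st_numbering (hR.dualGraph_connected h2)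
    (hR.dualGraph_induce_preconnected h2) hst
  obtain ⟨w, hw⟩ := R.exists_edge_weight h
  refine ⟨w, fun e he => ?_, isBalanced_of_numbering hinj (hR.face_symm_ne h2) hs hdown hup hw⟩
  induction e with
  | _ x y =>
    have h1 := hw ⟨(x, y), he⟩
    change w s(x, y) = _ at h1
    rw [h1]
    exact Nat.dist_pos_of_ne (hinj.ne (hR.face_symm_ne h2 _).symm)

theorem IsPlane.exists_other_face (hR : R.IsPlane) (h2 : G.IsVertexConnected 2) {x : V}
    (hx : (G.neighborSet x).ncard = 2) {F : R.Face} (hF : R.Incident x F) :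
    ∃ U ≠ F, ∀ F', R.Incident x F' ↔ F' = F ∨ F' = U := by
  obtain ⟨c, rfl, rfl⟩ := hF
  refine ⟨R.face c.symm, hR.face_symm_ne h2 c, fun F' => ⟨?_, ?_⟩⟩
  · rintro ⟨d, hd, rfl⟩
    by_cases hcd : c = d
    · exact Or.inl (by rw [hcd])
    · rw [← face_rot, rot_eq_of_degree_two (R := R) h2 hd.symm hcd hx]
      exact Or.inr rfl
  · rintro (rfl | rfl)
    · exact ⟨c, rfl, rfl⟩
    · exact ⟨R.rot c, R.rot_fst c, R.face_rot c⟩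

/-- Three vertices of degree two on a common face have edge weights to a new vertex in that face
that are tight against the face distances. -/
theorem IsPlane.exists_spoke_weights (hR : R.IsPlane) (hG : G.IsInternallyThreeConnected)
    (hV : 6 ≤ Nat.card V) {a : Fin 3 → V} (ha : Function.Injective a)
    (hdeg : ∀ i, (G.neighborSet (a i)).ncard = 2) {F₀ : R.Face} (hF₀ : ∀ i, R.Incident (a i) F₀)
    {w : Sym2 V → ℕ} (hw : ∀ e ∈ G.edgeSet, 0 < w e) :
    ∃ α : Fin 3 → ℚ, (∀ j, 0 < α j) ∧
      (∀ F, (R.faceDist w F₀ F : ℚ) ≤ ∑ j, R.vertexDist w (a j) F * α j) ∧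
      ∀ i, ∃ F, 0 < R.vertexDist w (a i) F ∧
        ∑ j, R.vertexDist w (a j) F * α j = (R.faceDist w F₀ F : ℚ) := by
  have := R.finite_face
  have hc := hR.dualGraph_connected hG.1
  choose U hUF₀ hU using fun i => hR.exists_other_face hG.1 (hdeg i) (hF₀ i)
  refine exists_tight_coefficients (fun F => R.faceDist w F₀ F)
    (fun j F => R.vertexDist w (a j) F) F₀ U (fun F => ?_) (fun j F => ?_) (fun i j hij => ?_) hUF₀
  · rw [faceDist_eq_zero_iff hc hw, eq_comm]
  · rw [vertexDist_eq_zero_iff hc hw ⟨F₀, hF₀ j⟩, hU]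
  -- Otherwise two vertices of degree two would share both `F₀` and the second face.
  · by_contra hne
    refine hUF₀ i (hR.face_eq_of_incident hG hV (ha.ne hne) (hdeg i) (hdeg j)
      ((hU i _).mpr (Or.inr rfl)) (hF₀ i) ((hU j _).mpr (Or.inr hij)) (hF₀ j))

end RotationSystem
end SimpleGraph

/-! ### Assembling the weights and the standing assumptions -/

namespace SimpleGraph
namespace RotationSystem

variable {V : Type*} {G : SimpleGraph V} {u v : V}

theorem deleteEdges_adj_of_notMem {w x : V} (h : G.Adj w x) (hx : x ∉ ({u, v} : Set V)) :
    (G.deleteEdges {s(u, v)}).Adj w x := by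
  refine deleteEdges_adj.mpr ⟨h, fun he => ?_⟩
  have : x ∈ s(u, v) := by
    rw [← Set.mem_singleton_iff.mp he]
    exact Sym2.mem_mk_right _ _
  exact hx (Sym2.mem_iff.mp this)

/-- Weights on the edges of `G` with prescribed values. -/
theorem exists_weight_extension (huv : u ≠ v) {a b : Fin 3 → ↥({u, v}ᶜ : Set V)}
    (ha : Function.Injective a) (hb : Function.Injective b) {w : Sym2 ↥({u, v}ᶜ : Set V) → ℕ}
    (hw : ∀ e ∈ (G.induce {u, v}ᶜ).edgeSet, 0 < w e) {α β : Fin 3 → ℕ} {γ : ℕ}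
    (hα : ∀ i, 0 < α i) (hβ : ∀ i, 0 < β i) (hγ : 0 < γ) :
    ∃ ω : Sym2 V → ℕ, (∀ e ∈ G.edgeSet, 0 < ω e) ∧ (∀ e, w e = ω (e.map Subtype.val)) ∧
      ω s(u, v) = γ ∧ (∀ i, ω s(u, ↑(a i)) = α i) ∧ ∀ i, ω s(v, ↑(b i)) = β i := by
  classical
  -- The default `1` only keeps the weight positive where no value is prescribed.
  let ω₁ : Sym2 V → ℕ := Function.extend (fun i => s(u, (a i : V))) α
    (Function.extend (fun i => s(v, (b i : V))) β 1)
  let ω₂ : Sym2 V → ℕ := fun e => if e = s(u, v) then γ else ω₁ e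
  let ω : Sym2 V → ℕ := Function.extend (Sym2.map Subtype.val) w ω₂
  have hmap : ∀ {x y : V}, x ∈ ({u, v} : Set V) →
      ¬ ∃ e : Sym2 ↥({u, v}ᶜ : Set V), e.map Subtype.val = s(x, y) := by
    rintro x y hx ⟨e, he⟩
    have : x ∈ e.map Subtype.val := he ▸ Sym2.mem_mk_left x y
    obtain ⟨z, -, rfl⟩ := Sym2.mem_map.mp this
    exact z.2 hx
  have hω₂ : ∀ {x y : V}, x ∈ ({u, v} : Set V) → ω s(x, y) = ω₂ s(x, y) := fun hx =>
    Function.extend_apply' _ _ _ (hmap hx)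
  have hω₂pos : ∀ e, 0 < ω₂ e := by
    intro e
    simp only [ω₂, ω₁, Function.extend_def]
    split_ifs
    · exact hγ
    · exact hα _
    · exact hβ _
    · exact one_pos
  have hu : u ∈ ({u, v} : Set V) := Or.inl rfl
  have hv : v ∈ ({u, v} : Set V) := Or.inr rfl
  have hau : ∀ i, (a i : V) ≠ u := fun i h => (a i).2 (Or.inl h)
  have hav : ∀ i, (a i : V) ≠ v := fun i h => (a i).2 (Or.inr h)
  have hbu : ∀ i, (b i : V) ≠ u := fun i h => (b i).2 (Or.inl h)
  have hbv : ∀ i, (b i : V) ≠ v := fun i h => (b i).2 (Or.inr h)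
  refine ⟨ω, fun e he => ?_, fun e => ?_, ?_, fun i => ?_, fun i => ?_⟩
  · by_cases hr : ∃ e' : Sym2 ↥({u, v}ᶜ : Set V), e'.map Subtype.val = e
    · obtain ⟨e', rfl⟩ := hr
      rw [show ω _ = _ from (Sym2.map.injective Subtype.val_injective).extend_apply _ _ _]
      refine hw e' ?_
      induction e' with
      | _ x y => exact he
    · rw [show ω e = _ from Function.extend_apply' _ _ _ hr]
      exact hω₂pos e
  · exact ((Sym2.map.injective Subtype.val_injective).extend_apply _ _ _).symm
  · rw [hω₂ hu]
    exact if_pos rfl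
  · have hne : s(u, (a i : V)) ≠ s(u, v) := fun h => hav i (Sym2.congr_right.mp h)
    have hinj : Function.Injective fun i => s(u, (a i : V)) := fun i j hij =>
      ha (Subtype.ext (Sym2.congr_right.mp hij))
    rw [hω₂ hu, show ω₂ _ = _ from if_neg hne]
    exact hinj.extend_apply _ _ i
  · have hne : s(v, (b i : V)) ≠ s(u, v) := fun h => by
      rw [Sym2.eq_swap (a := u)] at h
      exact hbu i (Sym2.congr_right.mp h)
    have hinj : Function.Injective fun i => s(v, (b i : V)) := fun i j hij =>
      hb (Subtype.ext (Sym2.congr_right.mp hij))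
    have hnr : ¬ ∃ j, s(u, (a j : V)) = s(v, (b i : V)) := by
      rintro ⟨j, hj⟩
      rcases Sym2.eq_iff.mp hj with h | h
      · exact huv h.1
      · exact hbu i h.1.symm
    rw [hω₂ hv, show ω₂ _ = _ from if_neg hne,
      show ω₁ _ = _ from Function.extend_apply' _ _ _ hnr]
    exact hinj.extend_apply _ _ i

theorem cast_sum_vertexDist_mul {R : RotationSystem G} (hc : R.dualGraph.Connected)
    (w : Sym2 V → ℕ) {a : Fin 3 → V} (ha : ∀ j, ∃ F, R.Incident (a j) F) {α : Fin 3 → ℚ}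
    {β : Fin 3 → ℕ} {n : ℕ} (hβ : ∀ i, (β i : ℚ) = n * α i) (k : ℕ) (F : R.Face) :
    ((∑ j, R.vertexDist (fun e => k * w e) (a j) F * β j : ℕ) : ℚ) =
      k * n * ∑ j, R.vertexDist w (a j) F * α j := by
  push_cast
  rw [Finset.mul_sum]
  refine Finset.sum_congr rfl fun j _ => ?_
  rw [vertexDist_mul hc w k (ha j), hβ]
  push_cast
  ring

theorem cast_faceDist_mul {R : RotationSystem G} (hc : R.dualGraph.Connected) (w : Sym2 V → ℕ)
    (n k : ℕ) (F F' : R.Face) :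
    ((R.faceDist (fun e => k * w e) F F' * n : ℕ) : ℚ) = k * n * R.faceDist w F F' := by
  rw [faceDist_mul hc]
  push_cast
  ring

variable [Finite V]

/-- If `G - uv` is cubic and `G - {u, v}` is 2-connected, then `u` and `v` have no common
neighbour. -/
theorem eq_of_adj_ends (hcubic : ∀ x, ((G.deleteEdges {s(u, v)}).neighborSet x).ncard = 3)
    (hK : (G.induce {u, v}ᶜ).IsVertexConnected 2) (x y z : V)
    (hxy : (G.deleteEdges {s(u, v)}).Adj x y) (hxz : (G.deleteEdges {s(u, v)}).Adj x z)
    (hy : y ∈ ({u, v} : Set V)) (hz : z ∈ ({u, v} : Set V)) : y = z := by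
  classical
  by_contra hyz
  have hx : x ∉ ({u, v} : Set V) := snd_notMem_of_fst_mem (y := ⟨(y, x), hxy.symm⟩) hy
  obtain ⟨p, -, hp⟩ := hK.exists_adj_ne ⟨x, hx⟩ ⟨x, hx⟩
  obtain ⟨q, hqp, hq⟩ := hK.exists_adj_ne ⟨x, hx⟩ p
  have hmem : ∀ {s : V} (r : ↥({u, v}ᶜ : Set V)), s ∈ ({u, v} : Set V) → s ≠ r :=
    fun {s} r hs h => r.2 (h ▸ hs)
  -- A common neighbour of `u` and `v` also has two neighbours in the 2-connected graph `G - {u,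
  -- v}`, which makes four.
  have hsub : (({y, z, p.1, q.1} : Finset V) : Set V) ⊆
      (G.deleteEdges {s(u, v)}).neighborSet x := by
    intro r hr
    simp only [Finset.coe_insert, Finset.coe_singleton, Set.mem_insert_iff,
      Set.mem_singleton_iff] at hr
    rcases hr with rfl | rfl | rfl | rfl
    · exact hxy
    · exact hxz
    · exact deleteEdges_adj_of_notMem hp p.2
    · exact deleteEdges_adj_of_notMem hq q.2
  have h1 := Set.ncard_le_ncard hsub
  have h2 : ({y, z, p.1, q.1} : Finset V).card = 4 := by
    refine Finset.card_eq_succ.mpr ⟨y, {z, p.1, q.1}, ?_, rfl, Finset.card_eq_three.mpr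
      ⟨z, p, q, hmem p hz, hmem q hz, fun h => hqp (Subtype.ext h.symm), rfl⟩⟩
    simp [hyz, hmem p hy, hmem q hy]
  rw [Set.ncard_coe_finset, h2, hcubic] at h1
  omega

/-- Of the three edges of `x` in `G - uv`, only the one to `w` is lost, as `x` is not adjacent to
both `u` and `v` there. -/
theorem ncard_neighborSet_induce_eq_two
    (hcubic : ∀ x, ((G.deleteEdges {s(u, v)}).neighborSet x).ncard = 3)
    (hK : (G.induce {u, v}ᶜ).IsVertexConnected 2) {w : V} (hw : w ∈ ({u, v} : Set V))
    (x : ↥({u, v}ᶜ : Set V)) (hx : G.Adj w x) :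
    ((G.induce {u, v}ᶜ).neighborSet x).ncard = 2 := by
  have hwx : (G.deleteEdges {s(u, v)}).Adj w x := deleteEdges_adj_of_notMem hx x.2
  have heq : (G.deleteEdges {s(u, v)}).neighborSet x =
      insert w (Subtype.val '' (G.induce {u, v}ᶜ).neighborSet x) := by
    ext y
    constructor
    · intro hy
      by_cases hyE : y ∈ ({u, v} : Set V)
      · exact Or.inl (eq_of_adj_ends hcubic hK x y w hy hwx.symm hyE hw)
      · exact Or.inr ⟨⟨y, hyE⟩, (deleteEdges_adj.mp hy).1, rfl⟩
    · rintro (rfl | ⟨y, hy, rfl⟩)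
      · exact hwx.symm
      · exact deleteEdges_adj_of_notMem hy y.2
  have hnot : w ∉ Subtype.val '' (G.induce {u, v}ᶜ).neighborSet x := by
    rintro ⟨y, -, rfl⟩
    exact y.2 hw
  have h := hcubic x
  rw [heq, Set.ncard_insert_of_notMem hnot, Set.ncard_image_of_injective _
    Subtype.val_injective] at h
  omega

/-- The standing assumptions of `EndsApart` hold if `G` is not planar. -/
theorem endsApart_of_not_isPlanar (huv : G.Adj u v) (hnonplanar : ¬ G.IsPlanar)
    (hcubic : ∀ x, ((G.deleteEdges {s(u, v)}).neighborSet x).ncard = 3)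
    (hconn : (G.deleteEdges {s(u, v)}).IsVertexConnected 2)
    (hK : (G.induce {u, v}ᶜ).IsVertexConnected 2)
    {M : (G.deleteEdges {s(u, v)}).RotationSystem} (hM : M.IsPlane) : M.EndsApart := by
  refine ⟨hM, hconn, eq_of_adj_ends hcubic hK, fun δ ε hδ hε hface => ?_⟩
  have hc := hconn.connected two_pos
  obtain hδ | hδ : δ.fst = u ∨ δ.fst = v := hδ <;> obtain hε | hε : ε.fst = u ∨ ε.fst = v := hε
  · exact hδ.trans hε.symm
  · exact absurd (hM.isPlanar_of_face_eq hc huv hδ hε hface) hnonplanar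
  · exact absurd (hM.isPlanar_of_face_eq hc huv hε hδ hface.symm) hnonplanar
  · exact hδ.trans hε.symm

end RotationSystem
end SimpleGraph

theorem mainTheorem3 {V : Type*} [Finite V] (G : SimpleGraph V) (u v : V) (huv : G.Adj u v)
    (hnonplanar : ¬ G.IsPlanar)
    (hcubic : ∀ x, ((G.deleteEdges {s(u, v)}).neighborSet x).ncard = 3)
    (hconn : (G.deleteEdges {s(u, v)}).IsVertexConnected 3)
    (hint : (G.induce {u, v}ᶜ).IsInternallyThreeConnected)
    -- a plane embedding of `G - uv`, and the embedding `N` of `G - {u, v}` that it induces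
    (M : (G.deleteEdges {s(u, v)}).RotationSystem) (hM : M.IsPlane)
    (N : (G.induce {u, v}ᶜ).RotationSystem) (hN : N = M.restrict (G.deleteEndsCopy u v))
    -- the other neighbours `u₁, u₂, u₃` of `u` and `v₁, v₂, v₃` of `v`
    (a b : Fin 3 → ↥({u, v}ᶜ : Set V)) (ha : Function.Injective a) (hb : Function.Injective b)
    (hua : ∀ i, G.Adj u (a i)) (hvb : ∀ i, G.Adj v (b i)) :
    ∃ Fu Fv : N.Face,
      -- `Fu` is the unique face incident with `u₁, u₂, u₃`, and likewise for `Fv`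
      (∀ F, (∀ i, N.Incident (a i) F) ↔ F = Fu) ∧
      (∀ F, (∀ i, N.Incident (b i) F) ↔ F = Fv) ∧
      ∃ ω : Sym2 V → ℕ, (∀ e ∈ G.edgeSet, 0 < ω e) ∧
        -- the weights of `G - {u, v}`, and thus of its dual
        ∃ w : Sym2 ↥({u, v}ᶜ : Set V) → ℕ, (∀ e, w e = ω (e.map Subtype.val)) ∧
        -- (1)
        N.IsBalanced w Fu Fv ∧
        -- (2)
        (∀ e ∈ (G.induce {u, v}ᶜ).edgeSet, ∀ e' ∈ (G.induce {u, v}ᶜ).edgeSet,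
          w e * w e' > N.faceDist w Fu Fv * ω s(u, v)) ∧
        -- (3)
        (∀ F, ∑ i, N.vertexDist w (a i) F * ω s(u, ↑(a i)) ≥ N.faceDist w Fu F * ω s(u, v)) ∧
        -- (4)
        (∀ i, ∃ U, 0 < N.vertexDist w (a i) U ∧
          ∑ j, N.vertexDist w (a j) U * ω s(u, ↑(a j)) = N.faceDist w Fu U * ω s(u, v)) ∧
        -- (5)
        (∀ F, ∑ i, N.vertexDist w (b i) F * ω s(v, ↑(b i)) ≥ N.faceDist w Fv F * ω s(u, v)) ∧
        -- (6)
        (∀ i, ∃ U, 0 < N.vertexDist w (b i) U ∧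
          ∑ j, N.vertexDist w (b j) U * ω s(v, ↑(b j)) = N.faceDist w Fv U * ω s(u, v)) ∧
        -- (7)
        (∀ i j, ∀ e ∈ (G.induce {u, v}ᶜ).edgeSet,
          (ω s(u, ↑(a i)) * ω s(v, ↑(b j)) : ℚ) < 1 / 9 * w e) := by
  classical
  subst hN
  have h2 := hconn.mono (j := 2) (by norm_num)
  have hK := hint.1
  have hends := SimpleGraph.RotationSystem.endsApart_of_not_isPlanar huv hnonplanar hcubic h2 hK hM
  have hN := hends.isPlane_restrict huv.ne (fun x _ => hcubic x) hK
  set N := M.restrict (G.deleteEndsCopy u v) with hNdef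
  have hu : u ∈ ({u, v} : Set V) := Or.inl rfl
  have hv : v ∈ ({u, v} : Set V) := Or.inr rfl
  have hdega := fun i =>
    SimpleGraph.RotationSystem.ncard_neighborSet_induce_eq_two hcubic hK hu (a i) (hua i)
  have hdegb := fun i =>
    SimpleGraph.RotationSystem.ncard_neighborSet_induce_eq_two hcubic hK hv (b i) (hvb i)
  have hua' := fun i =>
    SimpleGraph.RotationSystem.deleteEdges_adj_of_notMem (u := u) (v := v) (hua i) (a i).2
  have hvb' := fun i =>
    SimpleGraph.RotationSystem.deleteEdges_adj_of_notMem (u := u) (v := v) (hvb i) (b i).2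
  -- The six neighbours are distinct because `u` and `v` have none in common.
  have hV : 6 ≤ Nat.card ↥({u, v}ᶜ : Set V) := by
    have hinj : Function.Injective (Sum.elim a b) := by
      refine Function.Injective.sumElim ha hb fun i j hij => huv.ne ?_
      exact hends.eq_of_adj (a i) u v (hua' i).symm (hij ▸ (hvb' j).symm) hu hv
    have := Nat.card_le_card_of_injective _ hinj
    simpa using this
  have hNc := hN.dualGraph_connected hK
  obtain ⟨Fu, hFu⟩ := hends.exists_endFace hu
  obtain ⟨Fv, hFv⟩ := hends.exists_endFace hv
  choose c hc using fun i => hends.exists_endsDart_eq_facePerm (δ := ⟨(u, a i), hua' i⟩) hu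
  choose c' hc' using fun i => hends.exists_endsDart_eq_facePerm (δ := ⟨(v, b i), hvb' i⟩) hv
  have hFua : ∀ i, N.Incident (a i) Fu := fun i =>
    ⟨c i, Subtype.ext ((congrArg (fun d => d.fst) (hc i)).trans (M.facePerm_fst _)),
      hFu _ _ rfl (hc i)⟩
  have hFvb : ∀ i, N.Incident (b i) Fv := fun i =>
    ⟨c' i, Subtype.ext ((congrArg (fun d => d.fst) (hc' i)).trans (M.facePerm_fst _)),
      hFv _ _ rfl (hc' i)⟩
  have hFuv : Fu ≠ Fv := by
    rw [← hFu _ _ rfl (hc 0), ← hFv _ _ rfl (hc' 0)]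
    exact hends.endFace_ne rfl rfl huv.ne (hc 0) (hc' 0)
  obtain ⟨w, hw, hbal⟩ := hN.exists_balanced_weight hK hFuv
  obtain ⟨α, hα, hαle, hαeq⟩ := hN.exists_spoke_weights hint hV ha hdega hFua hw
  obtain ⟨β, hβ, hβle, hβeq⟩ := hN.exists_spoke_weights hint hV hb hdegb hFvb hw
  -- One denominator `γ` for both ends, as it becomes the weight of the single edge `uv`.
  obtain ⟨γ, hγ, η, hη, hηeq⟩ := exists_common_denominator (Sum.elim α β) (by
    rintro (i | i)
    · exact hα i
    · exact hβ i)
  -- The scale of the weights on `G - {u, v}`. The first summand gives condition 2, where the left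
  -- side grows like `k ^ 2` and the right side like `k`; the second bounds nine times every product
  -- `η (inl i) * η (inr j)`, for condition 7.
  set k : ℕ := N.faceDist w Fu Fv * γ +
    9 * ((∑ i, η (Sum.inl i)) * ∑ j, η (Sum.inr j)) + 1 with hk
  have hkpos : 0 < k := Nat.succ_pos _
  have hkw : ∀ e ∈ (G.induce {u, v}ᶜ).edgeSet, k ≤ k * w e := fun e he =>
    Nat.le_mul_of_pos_right k (hw e he)
  obtain ⟨ω, hωpos, hωw, hωuv, hωa, hωb⟩ :=
    SimpleGraph.RotationSystem.exists_weight_extension (G := G) huv.ne ha hb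
      (w := fun e => k * w e) (fun e he => Nat.mul_pos hkpos (hw e he))
      (fun i => hη (Sum.inl i)) (fun i => hη (Sum.inr i)) hγ
  have hle : ∀ {x : Fin 3 → ↥({u, v}ᶜ : Set V)} {ξ : Fin 3 → ℚ} {ζ : Fin 3 → ℕ} {F₀ : N.Face},
      (∀ j, ∃ F, N.Incident (x j) F) → (∀ i, (ζ i : ℚ) = γ * ξ i) → ∀ F,
      (N.faceDist w F₀ F : ℚ) ≤ ∑ j, N.vertexDist w (x j) F * ξ j →
      N.faceDist (fun e => k * w e) F₀ F * γ ≤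
        ∑ j, N.vertexDist (fun e => k * w e) (x j) F * ζ j := by
    intro x ξ ζ F₀ hx hζ F hF
    rw [← Nat.cast_le (α := ℚ), SimpleGraph.RotationSystem.cast_sum_vertexDist_mul hNc w hx hζ,
      SimpleGraph.RotationSystem.cast_faceDist_mul hNc]
    exact mul_le_mul_of_nonneg_left hF (by positivity)
  have heq : ∀ {x : Fin 3 → ↥({u, v}ᶜ : Set V)} {ξ : Fin 3 → ℚ} {ζ : Fin 3 → ℕ} {F₀ : N.Face},
      (∀ j, ∃ F, N.Incident (x j) F) → (∀ i, (ζ i : ℚ) = γ * ξ i) → ∀ F,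
      ∑ j, N.vertexDist w (x j) F * ξ j = (N.faceDist w F₀ F : ℚ) →
      ∑ j, N.vertexDist (fun e => k * w e) (x j) F * ζ j =
        N.faceDist (fun e => k * w e) F₀ F * γ := by
    intro x ξ ζ F₀ hx hζ F hF
    rw [← Nat.cast_inj (R := ℚ), SimpleGraph.RotationSystem.cast_sum_vertexDist_mul hNc w hx hζ,
      SimpleGraph.RotationSystem.cast_faceDist_mul hNc, hF]
  have hpos : ∀ {x : ↥({u, v}ᶜ : Set V)} {F₀ U : N.Face}, N.Incident x F₀ →
      0 < N.vertexDist w x U → 0 < N.vertexDist (fun e => k * w e) x U := by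
    intro x F₀ U hx hU
    rw [SimpleGraph.RotationSystem.vertexDist_mul hNc w k ⟨F₀, hx⟩]
    exact Nat.mul_pos hkpos hU
  refine ⟨Fu, Fv, fun F => ⟨fun hF => ?_, fun hF => hF ▸ hFua⟩,
    fun F => ⟨fun hF => ?_, fun hF => hF ▸ hFvb⟩, ω, hωpos, fun e => k * w e, hωw, hbal.mul hNc k,
    fun e he e' he' => ?_, fun F => ?_, fun i => ?_, fun F => ?_, fun i => ?_,
    fun i j e he => ?_⟩
  -- Two of the three vertices already determine the face.
  · exact hN.face_eq_of_incident hint hV (ha.ne (by decide : (0 : Fin 3) ≠ 1)) (hdega 0) (hdega 1)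
      (hF 0) (hFua 0) (hF 1) (hFua 1)
  · exact hN.face_eq_of_incident hint hV (hb.ne (by decide : (0 : Fin 3) ≠ 1)) (hdegb 0) (hdegb 1)
      (hF 0) (hFvb 0) (hF 1) (hFvb 1)
  · rw [SimpleGraph.RotationSystem.faceDist_mul hNc, hωuv, gt_iff_lt, mul_assoc]
    refine lt_of_lt_of_le ?_ (Nat.mul_le_mul (hkw e he) (hkw e' he'))
    exact Nat.mul_lt_mul_of_pos_left (by omega) hkpos
  · simp only [hωa, hωuv, ge_iff_le]
    exact hle (fun j => ⟨_, hFua j⟩) (fun i => hηeq (Sum.inl i)) F (hαle F)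
  · obtain ⟨U, hU, hUeq⟩ := hαeq i
    simp only [hωa, hωuv]
    exact ⟨U, hpos (hFua i) hU, heq (fun j => ⟨_, hFua j⟩) (fun i => hηeq (Sum.inl i)) U hUeq⟩
  · simp only [hωb, hωuv, ge_iff_le]
    exact hle (fun j => ⟨_, hFvb j⟩) (fun i => hηeq (Sum.inr i)) F (hβle F)
  · obtain ⟨U, hU, hUeq⟩ := hβeq i
    simp only [hωb, hωuv]
    exact ⟨U, hpos (hFvb i) hU, heq (fun j => ⟨_, hFvb j⟩) (fun i => hηeq (Sum.inr i)) U hUeq⟩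
  · rw [hωa, hωb]
    have h1 : η (Sum.inl i) * η (Sum.inr j) ≤
        (∑ i, η (Sum.inl i)) * ∑ j, η (Sum.inr j) :=
      Nat.mul_le_mul (Finset.single_le_sum (f := fun i => η (Sum.inl i))
          (fun _ _ => Nat.zero_le _) (Finset.mem_univ i))
        (Finset.single_le_sum (f := fun i => η (Sum.inr i))
          (fun _ _ => Nat.zero_le _) (Finset.mem_univ j))
    have h3 : 9 * (η (Sum.inl i) * η (Sum.inr j)) < k * w e :=
      lt_of_lt_of_le (by omega) (hkw e he)
    have h4 : (9 * (η (Sum.inl i) * η (Sum.inr j)) : ℚ) < (k * w e : ℕ) := by exact_mod_cast h3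
    linarith
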